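/- Let $\mathfrak g\subset\mathfrak{gl}(n,\mathbb R)$ be a real semisimple Lie algebra with complexification $\mathfrak g^{\mathbb C}=\mathfrak g+\sqrt{-1}\,\mathfrak g\subset\mathfrak{gl}(n,\mathbb C)$, and let $\mathfrak c$ be a Cartan subalgebra of $\mathfrak g$, i.e. a maximal abelian subalgebra which is diagonalizable in $\mathfrak g^{\mathbb C}$. Let $\sigma(X+\sqrt{-1}\,Y)=X-\sqrt{-1}\,Y$ for $X,Y\in\mathfrak g$, and for a complex linear function $\mu$ on $\mathfrak c^{\mathbb C}$ put $\mu^\sigma(H)=\overline{\mu(\sigma(H))}$. Let $R^+$ be a positive system of roots of $\mathfrak c^{\mathbb C}$ in $\mathfrak g^{\mathbb C}$, and let $\mathfrak y=\sum_{\alpha\in R^+}(\mathfrak g^{\mathbb C})_\alpha$ be the nilradical of the corresponding Borel subalgebra. For a simple root $\alpha$ choose $X_{\alpha}\in(\mathfrak g^{\mathbb C})_{\alpha}$, $X_{-\alpha}\in(\mathfrak g^{\mathbb C})_{-\alpha}$ and $0\ne H_\alpha\in\mathfrak c^{\mathbb C}$ with $[X_\alpha,X_{-\alpha}]=H_\alpha$,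 $[H_\alpha,X_{\pm\alpha}]=\pm2X_{\pm\alpha}$. Write $s_\alpha(\mu)=\mu-\mu(H_\alpha)\alpha$ for the corresponding reflection and $w_\alpha=\exp(X_\alpha)\exp(-X_{-\alpha})\exp(X_\alpha)\in \mathrm{GL}(n,\mathbb C)$. Let $\rho:\mathfrak g\to\mathfrak{gl}(V)$ be a representation on a finite dimensional real vector space $V$, with complexification $\rho^{\mathbb C}:\mathfrak g^{\mathbb C}\to\mathfrak{gl}(V^{\mathbb C})$, and put $w_{\alpha,\rho}=\exp(\rho^{\mathbb C}(X_\alpha))\exp(-\rho^{\mathbb C}(X_{-\alpha}))\exp(\rho^{\mathbb C}(X_\alpha))$. A vector $v\in V^{\mathbb C}$ is a high weight vector of weight $\lambda$ for the pair $(\mathfrak y,\mathfrak c^{\mathbb C})$ if $v\neq0$, $\rho^{\mathbb C}(\mathfrak y)v=0$ and $\rho^{\mathbb C}(H)v=\lambda(H)v$ for all $H\in\mathfrak c^{\mathbb C}$. Then there are simple roots $\beta_1,\dots,\beta_l$ (with elements $X_{\pm\beta_j},H_{\beta_j}$ as above) such that $s_{\beta_1}\cdots s_{\beta_l}(R^+)=\{\alpha^\sigma\mid\alpha\in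 R^+\}$. For every such choice put $\omega=w_{\beta_1}\cdots w_{\beta_l}$ and $\omega_\rho=w_{\beta_1,\rho}\cdots w_{\beta_l,\rho}$. Then $\omega$ normalizes $\mathfrak c^{\mathbb C}$, and the following holds. If $v\in V^{\mathbb C}$ is a high weight vector of weight $\lambda$ for the pair $(\mathfrak y,\mathfrak c^{\mathbb C})$, then $\omega_\rho^{-1}\overline v$ is a high weight vector for the pair $(\mathfrak y,\mathfrak c^{\mathbb C})$ with weight $\omega^{-1}\lambda^\sigma$, where $(\omega^{-1}\mu)(H)=\mu(\omega H\omega^{-1})$. Moreover, the linear span $\langle G^{\mathbb C}_\rho\overline v\rangle$ of the orbit of $\overline v$ is an irreducible $\mathfrak g^{\mathbb C}$-invariant subspace of $V^{\mathbb C}$, it contains $\omega_\rho^{-1}\overline v$, and it is the only irreducible invariant subspace that does; here $G^{\mathbb C}_\rho\subset\mathrm{GL}(V^{\mathbb C})$ is the subgroup generated by the complex one-parameter subgroups $\{\exp(z\rho(X))\mid z\in\mathbb C\}$, $X\in\mathfrak g$. -/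

import Mathlib

open scoped TensorProduct

attribute [local instance 100] LieRing.ofAssociativeRing

noncomputable section

namespace RealRep

/-! ### Complexification of a real matrix Lie algebra -/

/-- The complexification `L + i L` of a real Lie algebra `L` of `n × n` matrices: the complex matrices
whose real and imaginary parts lie in `L`. -/
def complexify {n : ℕ} (L : LieSubalgebra ℝ (Matrix (Fin n) (Fin n) ℝ)) :
    LieSubalgebra ℂ (Matrix (Fin n) (Fin n) ℂ) where
  carrier := {Z | Z.map Complex.re ∈ L ∧ Z.map Complex.im ∈ L}
  add_mem' := by
    rintro a b ⟨ha, ha'⟩ ⟨hb, hb'⟩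
    refine ⟨?_, ?_⟩
    · have : (a + b).map Complex.re = a.map Complex.re + b.map Complex.re := by
        ext i j; simp
      rw [this]; exact L.add_mem ha hb
    · have : (a + b).map Complex.im = a.map Complex.im + b.map Complex.im := by
        ext i j; simp
      rw [this]; exact L.add_mem ha' hb'
  zero_mem' := by
    refine ⟨?_, ?_⟩
    · have : (0 : Matrix (Fin n) (Fin n) ℂ).map Complex.re = 0 := by ext i j; simp
      rw [this]; exact L.zero_mem
    · have : (0 : Matrix (Fin n) (Fin n) ℂ).map Complex.im = 0 := by ext i j; simp
      rw [this]; exact L.zero_mem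
  smul_mem' := by
    rintro c a ⟨ha, ha'⟩
    refine ⟨?_, ?_⟩
    · have : (c • a).map Complex.re = c.re • a.map Complex.re - c.im • a.map Complex.im := by
        ext i j; simp
      rw [this]; exact L.sub_mem (L.smul_mem _ ha) (L.smul_mem _ ha')
    · have : (c • a).map Complex.im = c.re • a.map Complex.im + c.im • a.map Complex.re := by
        ext i j; simp
      rw [this]; exact L.add_mem (L.smul_mem _ ha') (L.smul_mem _ ha)
  lie_mem' := by
    rintro a b ⟨ha, ha'⟩ ⟨hb, hb'⟩
    refine ⟨?_, ?_⟩
    · have : (⁅a, b⁆).map Complex.re =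
          ⁅a.map Complex.re, b.map Complex.re⁆ - ⁅a.map Complex.im, b.map Complex.im⁆ := by
        ext i j
        simp [Ring.lie_def, Matrix.mul_apply, Finset.sum_sub_distrib]
        ring
      rw [this]; exact L.sub_mem (L.lie_mem ha hb) (L.lie_mem ha' hb')
    · have : (⁅a, b⁆).map Complex.im =
          ⁅a.map Complex.re, b.map Complex.im⁆ + ⁅a.map Complex.im, b.map Complex.re⁆ := by
        ext i j
        simp [Ring.lie_def, Matrix.mul_apply, Finset.sum_add_distrib]
        ring
      rw [this]; exact L.add_mem (L.lie_mem ha hb') (L.lie_mem ha' hb)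

variable {n : ℕ}

/-- The real part of an element of `L + i L`, as an element of `L`. -/
def rePart {L : LieSubalgebra ℝ (Matrix (Fin n) (Fin n) ℝ)} (Z : complexify L) : L :=
  ⟨(Z : Matrix (Fin n) (Fin n) ℂ).map Complex.re, Z.2.1⟩

/-- The imaginary part of an element of `L + i L`, as an element of `L`. -/
def imPart {L : LieSubalgebra ℝ (Matrix (Fin n) (Fin n) ℝ)} (Z : complexify L) : L :=
  ⟨(Z : Matrix (Fin n) (Fin n) ℂ).map Complex.im, Z.2.2⟩

/-- The conjugation `X + i Y ↦ X - i Y` of `L + i L`, for `X, Y ∈ L`. -/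
def conjL {L : LieSubalgebra ℝ (Matrix (Fin n) (Fin n) ℝ)} (Z : complexify L) : complexify L :=
  ⟨(Z : Matrix (Fin n) (Fin n) ℂ).map (starRingEnd ℂ), by
    refine ⟨?_, ?_⟩
    · have : ((Z : Matrix (Fin n) (Fin n) ℂ).map (starRingEnd ℂ)).map Complex.re =
          (Z : Matrix (Fin n) (Fin n) ℂ).map Complex.re := by ext i j; simp
      rw [this]; exact Z.2.1
    · have : ((Z : Matrix (Fin n) (Fin n) ℂ).map (starRingEnd ℂ)).map Complex.im =
          -(Z : Matrix (Fin n) (Fin n) ℂ).map Complex.im := by ext i j; simp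
      rw [this]; exact L.neg_mem Z.2.2⟩

/-- For a complex linear function `μ` on `𝔠 + i 𝔠`, the complex linear function `μ^σ` given by
`μ^σ(H) = conj (μ (σ H))`. -/
def conjDual {𝔠 : LieSubalgebra ℝ (Matrix (Fin n) (Fin n) ℝ)}
    (μ : Module.Dual ℂ (complexify 𝔠)) : Module.Dual ℂ (complexify 𝔠) where
  toFun H := starRingEnd ℂ (μ (conjL H))
  map_add' a b := by
    have : conjL (a + b) = conjL a + conjL b := by
      ext i j; simp [conjL]
    rw [this, map_add, map_add]
  map_smul' c a := by
    have : conjL (c • a) = (starRingEnd ℂ c) • conjL a := by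
      ext i j; simp [conjL]
    rw [this, map_smul]; simp

/-! ### Roots and positive systems -/

section Roots

variable (𝔤 𝔠 : LieSubalgebra ℝ (Matrix (Fin n) (Fin n) ℝ))

/-- The simultaneous eigenspace of `𝔠 + i 𝔠` in `𝔤 + i 𝔤` (adjoint action) for the linear
function `α`. -/
def rootSpace (α : Module.Dual ℂ (complexify 𝔠)) : Submodule ℂ (Matrix (Fin n) (Fin n) ℂ) where
  carrier := {Z | Z ∈ complexify 𝔤 ∧
    ∀ H : complexify 𝔠, ⁅(H : Matrix (Fin n) (Fin n) ℂ), Z⁆ = α H • Z}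
  add_mem' := by
    rintro a b ⟨ha, ha'⟩ ⟨hb, hb'⟩
    exact ⟨(complexify 𝔤).add_mem ha hb, fun H => by rw [lie_add, ha', hb', smul_add]⟩
  zero_mem' := ⟨(complexify 𝔤).zero_mem, fun H => by simp⟩
  smul_mem' := by
    rintro c a ⟨ha, ha'⟩
    exact ⟨(complexify 𝔤).smul_mem c ha, fun H => by rw [lie_smul, ha', smul_comm]⟩

/-- `𝔠` is a Cartan subalgebra of `𝔤`: a maximal abelian subalgebra of `𝔤` which is diagonalizable
in the complexification of `𝔤`. -/
structure IsCartan : Prop where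
  le : 𝔠 ≤ 𝔤
  abelian : ∀ x ∈ 𝔠, ∀ y ∈ 𝔠, ⁅x, y⁆ = 0
  maximal : ∀ 𝔞 : LieSubalgebra ℝ (Matrix (Fin n) (Fin n) ℝ), 𝔠 ≤ 𝔞 → 𝔞 ≤ 𝔤 →
    (∀ x ∈ 𝔞, ∀ y ∈ 𝔞, ⁅x, y⁆ = 0) → 𝔞 = 𝔠
  diagonalizable : (complexify 𝔤).toSubmodule ≤
    ⨆ α : Module.Dual ℂ (complexify 𝔠), rootSpace 𝔤 𝔠 α

/-- `α` is a root of `𝔠 + i 𝔠` in `𝔤 + i 𝔤`. -/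
def IsRoot (α : Module.Dual ℂ (complexify 𝔠)) : Prop :=
  α ≠ 0 ∧ rootSpace 𝔤 𝔠 α ≠ ⊥

/-- `P` is a positive system of roots: it contains exactly one of `α, -α` for every root `α`, and it
is closed under those sums that are roots. (These are the systems given by the Borel subalgebras
containing `𝔠 + i 𝔠`.) -/
structure IsPositiveSystem (P : Set (Module.Dual ℂ (complexify 𝔠))) : Prop where
  isRoot : ∀ α ∈ P, IsRoot 𝔤 𝔠 α
  pos_or_neg : ∀ α, IsRoot 𝔤 𝔠 α → α ∈ P ∨ -α ∈ P
  neg_notMem : ∀ α ∈ P, -α ∉ P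
  closed : ∀ α ∈ P, ∀ β ∈ P, IsRoot 𝔤 𝔠 (α + β) → α + β ∈ P

/-- The nilradical `𝔶` of the Borel subalgebra determined by `P`: the span of the root spaces of the
positive roots. -/
def nilradical (P : Set (Module.Dual ℂ (complexify 𝔠))) :
    Submodule ℂ (Matrix (Fin n) (Fin n) ℂ) :=
  ⨆ α ∈ P, rootSpace 𝔤 𝔠 α

/-- A simple root: a positive root which is not a sum of two positive roots. -/
def IsSimpleRoot {𝔠 : LieSubalgebra ℝ (Matrix (Fin n) (Fin n) ℝ)}
    (P : Set (Module.Dual ℂ (complexify 𝔠))) (α : Module.Dual ℂ (complexify 𝔠)) : Prop :=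
  α ∈ P ∧ ∀ β ∈ P, ∀ γ ∈ P, α ≠ β + γ

/-- A simple root `α` together with a standard copy of `𝔰𝔩(2, ℂ)` for it: root vectors
`X = X_α`, `Y = X_{-α}` and `H = H_α` with `[X, Y] = H ≠ 0`, `[H, X] = 2X`, `[H, Y] = -2Y`. -/
structure SimpleTriple (P : Set (Module.Dual ℂ (complexify 𝔠))) where
  α : Module.Dual ℂ (complexify 𝔠)
  X : complexify 𝔤
  Y : complexify 𝔤
  H : complexify 𝔠
  simple : IsSimpleRoot P α
  X_mem : (X : Matrix (Fin n) (Fin n) ℂ) ∈ rootSpace 𝔤 𝔠 α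
  Y_mem : (Y : Matrix (Fin n) (Fin n) ℂ) ∈ rootSpace 𝔤 𝔠 (-α)
  sl2 : IsSl2Triple (H : Matrix (Fin n) (Fin n) ℂ) (X : Matrix (Fin n) (Fin n) ℂ)
    (Y : Matrix (Fin n) (Fin n) ℂ)

end Roots

/-! ### Exponentials -/

/-- The exponential of a complex matrix, as an invertible matrix. -/
def expMat {m : ℕ} (A : Matrix (Fin m) (Fin m) ℂ) : Matrix.GeneralLinearGroup (Fin m) ℂ where
  val := NormedSpace.exp A
  inv := NormedSpace.exp (-A)
  val_inv := by
    rw [← Matrix.exp_add_of_commute _ _ (Commute.neg_right (Commute.refl A)), add_neg_cancel,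
      NormedSpace.exp_zero]
  inv_val := by
    rw [← Matrix.exp_add_of_commute _ _ (Commute.neg_left (Commute.refl A)), neg_add_cancel,
      NormedSpace.exp_zero]

/-- The exponential of an endomorphism of a finite dimensional complex vector space, as an element of
the general linear group. It is computed in a basis, and does not depend on it. -/
def expGL {W : Type*} [AddCommGroup W] [Module ℂ W] [Module.Finite ℂ W] (T : Module.End ℂ W) :
    LinearMap.GeneralLinearGroup ℂ W :=
  Units.map ((LinearMap.toMatrixAlgEquiv (Module.finBasis ℂ W)).symm :
      Matrix (Fin (Module.finrank ℂ W)) (Fin (Module.finrank ℂ W)) ℂ →* Module.End ℂ W)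
    (expMat (LinearMap.toMatrixAlgEquiv (Module.finBasis ℂ W) T))

/-! ### The Weyl group -/

section Weyl

variable {𝔤 𝔠 : LieSubalgebra ℝ (Matrix (Fin n) (Fin n) ℝ)}
  {P : Set (Module.Dual ℂ (complexify 𝔠))}

/-- The reflection `μ ↦ μ - μ(H_α) α`. -/
def SimpleTriple.reflection (t : SimpleTriple 𝔤 𝔠 P) :
    Module.End ℂ (Module.Dual ℂ (complexify 𝔠)) :=
  Module.preReflection t.α (Module.Dual.eval ℂ (complexify 𝔠) t.H)

/-- `w_α = exp(X_α) exp(-X_{-α}) exp(X_α)`. -/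
def SimpleTriple.weyl (t : SimpleTriple 𝔤 𝔠 P) : Matrix.GeneralLinearGroup (Fin n) ℂ :=
  expMat (t.X : Matrix (Fin n) (Fin n) ℂ) * expMat (-(t.Y : Matrix (Fin n) (Fin n) ℂ)) *
    expMat (t.X : Matrix (Fin n) (Fin n) ℂ)

/-- `w_{β₁} ⋯ w_{β_l}(R⁺) = p(R⁺)`, where `w_β` are the reflections in the given simple roots and `p`
is the permutation `α ↦ α^σ` of the roots. -/
def IsConjugatingWord (s : List (SimpleTriple 𝔤 𝔠 P)) : Prop :=
  (fun α => (s.map SimpleTriple.reflection).prod α) '' P = conjDual '' P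

/-- `ω = w_{β₁} ⋯ w_{β_l}` in `GL(n, ℂ)`. -/
def omega (s : List (SimpleTriple 𝔤 𝔠 P)) : Matrix.GeneralLinearGroup (Fin n) ℂ :=
  (s.map SimpleTriple.weyl).prod

end Weyl

/-- The normalizer of `𝔠 + i 𝔠` in `GL(n, ℂ)`. -/
def cartanNormalizer (𝔠 : LieSubalgebra ℝ (Matrix (Fin n) (Fin n) ℝ)) :
    Subgroup (Matrix.GeneralLinearGroup (Fin n) ℂ) where
  carrier := {g | ∀ Z : Matrix (Fin n) (Fin n) ℂ,
    g.val * Z * (g⁻¹).val ∈ complexify 𝔠 ↔ Z ∈ complexify 𝔠}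
  one_mem' := by intro Z; simp
  mul_mem' := by
    intro a b ha hb Z
    have h := (ha (b.val * Z * (b⁻¹).val)).trans (hb Z)
    simpa only [mul_inv_rev, Units.val_mul, mul_assoc] using h
  inv_mem' := by
    intro a ha Z
    have h := ha ((a⁻¹).val * Z * ((a⁻¹)⁻¹).val)
    rw [← h, inv_inv]
    have : a.val * ((a⁻¹).val * Z * a.val) * (a⁻¹).val = Z := by
      rw [mul_assoc (a⁻¹).val, Units.mul_inv_cancel_left, mul_assoc, Units.mul_inv, mul_one]
    rw [this]

/-- The action `(g μ)(H) = μ(g⁻¹ H g)` of the normalizer of `𝔠 + i 𝔠` on the complex linear functions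
on `𝔠 + i 𝔠`. -/
def dualAct {𝔠 : LieSubalgebra ℝ (Matrix (Fin n) (Fin n) ℝ)} (g : cartanNormalizer 𝔠)
    (μ : Module.Dual ℂ (complexify 𝔠)) : Module.Dual ℂ (complexify 𝔠) where
  toFun H := μ ⟨((g⁻¹ : cartanNormalizer 𝔠) : Matrix.GeneralLinearGroup (Fin n) ℂ).val *
      (H : Matrix (Fin n) (Fin n) ℂ) * (g : Matrix.GeneralLinearGroup (Fin n) ℂ).val, by
    have h := ((g⁻¹).2 (H : Matrix (Fin n) (Fin n) ℂ)).2 H.2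
    simpa using h⟩
  map_add' a b := by
    rw [← map_add]; congr 1; ext1; simp [mul_add, add_mul]
  map_smul' c a := by
    rw [RingHom.id_apply, ← map_smul]; congr 1; ext1; simp

/-! ### Representations -/

section Rep

variable {V : Type*} [AddCommGroup V] [Module ℝ V]
variable {𝔤 : LieSubalgebra ℝ (Matrix (Fin n) (Fin n) ℝ)}

/-- The conjugation of `V^ℂ = ℂ ⊗ V`: `z ⊗ v ↦ conj z ⊗ v`. -/
def conjV : ℂ ⊗[ℝ] V →ₗ[ℝ] ℂ ⊗[ℝ] V :=
  LinearMap.rTensor V Complex.conjAe.toLinearMap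

/-- The complexification of a representation:
`ρ^ℂ(X + i Y) = ρ(X) + i ρ(Y)` on `ℂ ⊗ V`, for `X, Y ∈ 𝔤`. -/
def rhoC (ρ : 𝔤 →ₗ⁅ℝ⁆ Module.End ℝ V) : complexify 𝔤 →ₗ⁅ℂ⁆ Module.End ℂ (ℂ ⊗[ℝ] V) where
  toFun Z := (ρ (rePart Z)).baseChange ℂ + Complex.I • (ρ (imPart Z)).baseChange ℂ
  map_add' a b := by
    have h1 : rePart (a + b) = rePart a + rePart b := by ext i j; simp [rePart]
    have h2 : imPart (a + b) = imPart a + imPart b := by ext i j; simp [imPart]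
    rw [h1, h2, map_add, map_add, LinearMap.baseChange_add, LinearMap.baseChange_add, smul_add]
    abel
  map_smul' c a := by
    have h1 : rePart (c • a) = c.re • rePart a - c.im • imPart a := by
      ext i j; simp [rePart, imPart]
    have h2 : imPart (c • a) = c.re • imPart a + c.im • rePart a := by
      ext i j; simp [rePart, imPart]
    rw [h1, h2, map_sub, map_add, map_smul, map_smul, map_smul, map_smul]
    refine TensorProduct.AlgebraTensorModule.curry_injective ?_
    ext v
    simp only [TensorProduct.AlgebraTensorModule.curry_apply, 
      TensorProduct.curry_apply, LinearMap.add_apply, LinearMap.smul_apply,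
      LinearMap.baseChange_tmul, LinearMap.coe_restrictScalars, LinearMap.sub_apply,
      TensorProduct.tmul_sub, TensorProduct.tmul_add, RingHom.id_apply,
      ← TensorProduct.smul_tmul, TensorProduct.smul_tmul', smul_add]
    simp only [smul_eq_mul, mul_one, Complex.real_smul]
    have hc : c = c.re + c.im * Complex.I := (Complex.re_add_im c).symm
    have e1 : c • (1 : ℂ) = (c.re : ℂ) + Complex.I * c.im := by
      rw [smul_eq_mul, mul_one]; conv_lhs => rw [hc]
      ring
    have e2 : c * Complex.I = Complex.I * c.re - c.im := by
      conv_lhs => rw [hc]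
      linear_combination (c.im : ℂ) * Complex.I_mul_I
    simp only [smul_eq_mul, mul_one] at e1
    clear hc
    generalize c.re = x at e1 e2 ⊢
    generalize c.im = y at e1 e2 ⊢
    rw [e2, e1]
    simp only [TensorProduct.add_tmul, TensorProduct.sub_tmul]
    abel
  map_lie' := by
    intro a b
    have h1 : rePart ⁅a, b⁆ = ⁅rePart a, rePart b⁆ - ⁅imPart a, imPart b⁆ := by
      ext i j
      simp [rePart, imPart, Ring.lie_def, Matrix.mul_apply, Finset.sum_sub_distrib]
      ring
    have h2 : imPart ⁅a, b⁆ = ⁅rePart a, imPart b⁆ + ⁅imPart a, rePart b⁆ := by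
      ext i j
      simp [rePart, imPart, Ring.lie_def, Matrix.mul_apply, Finset.sum_add_distrib]
      ring
    have hb : ∀ f g : Module.End ℝ V,
        (⁅f, g⁆).baseChange ℂ = ⁅f.baseChange ℂ, g.baseChange ℂ⁆ := by
      intro f g
      simp only [Ring.lie_def, LinearMap.baseChange_sub, LinearMap.baseChange_mul]
    have key : ∀ A B C D : Module.End ℂ (ℂ ⊗[ℝ] V),
        ⁅A, C⁆ - ⁅B, D⁆ + Complex.I • (⁅A, D⁆ + ⁅B, C⁆) =
          ⁅A + Complex.I • B, C + Complex.I • D⁆ := by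
      intro A B C D
      simp only [Ring.lie_def, add_mul, mul_add, smul_mul_assoc, mul_smul_comm, smul_add, smul_sub,
        smul_smul, Complex.I_mul_I, neg_smul, one_smul]
      abel
    rw [h1, h2, map_sub, map_add, LieHom.map_lie, LieHom.map_lie, LieHom.map_lie, LieHom.map_lie,
      LinearMap.baseChange_sub, LinearMap.baseChange_add, hb, hb, hb, hb]
    exact key _ _ _ _

variable {𝔠 : LieSubalgebra ℝ (Matrix (Fin n) (Fin n) ℝ)}

/-- `v` is a high weight vector of `ρ^ℂ`, of weight `μ`, for the pair `(𝔶, 𝔠 + i 𝔠)`, where `𝔶` is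
the nilradical determined by `P`. -/
structure IsHighWeightVector (P : Set (Module.Dual ℂ (complexify 𝔠)))
    (ρ : 𝔤 →ₗ⁅ℝ⁆ Module.End ℝ V) (v : ℂ ⊗[ℝ] V) (μ : Module.Dual ℂ (complexify 𝔠)) : Prop where
  ne_zero : v ≠ 0
  nil : ∀ N : complexify 𝔤, (N : Matrix (Fin n) (Fin n) ℂ) ∈ nilradical 𝔤 𝔠 P → rhoC ρ N v = 0
  weight : ∀ (H : complexify 𝔤) (hH : (H : Matrix (Fin n) (Fin n) ℂ) ∈ complexify 𝔠),
    rhoC ρ H v = μ ⟨H, hH⟩ • v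

/-- `W` is invariant under `ρ^ℂ(𝔤 + i 𝔤)`. -/
def IsInvariant (ρ : 𝔤 →ₗ⁅ℝ⁆ Module.End ℝ V) (W : Submodule ℂ (ℂ ⊗[ℝ] V)) : Prop :=
  ∀ Z : complexify 𝔤, ∀ w ∈ W, rhoC ρ Z w ∈ W

/-- `W` is an irreducible invariant subspace of `V^ℂ`. -/
structure IsIrreducible (ρ : 𝔤 →ₗ⁅ℝ⁆ Module.End ℝ V) (W : Submodule ℂ (ℂ ⊗[ℝ] V)) : Prop where
  ne_bot : W ≠ ⊥
  invariant : IsInvariant ρ W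
  eq_bot_or_eq : ∀ U ≤ W, IsInvariant ρ U → U = ⊥ ∨ U = W

variable [Module.Finite ℝ V]

/-- The subgroup of `GL(V^ℂ)` generated by the complex one-parameter groups `exp(z ρ(X))`, for
`z ∈ ℂ` and `X ∈ 𝔤`. -/
def groupC (ρ : 𝔤 →ₗ⁅ℝ⁆ Module.End ℝ V) :
    Subgroup (LinearMap.GeneralLinearGroup ℂ (ℂ ⊗[ℝ] V)) :=
  Subgroup.closure {g | ∃ (z : ℂ) (X : 𝔤), g = expGL (z • (ρ X).baseChange ℂ)}

/-- The linear span of the orbit of `v` under `groupC ρ`. -/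
def orbitSpan (ρ : 𝔤 →ₗ⁅ℝ⁆ Module.End ℝ V) (v : ℂ ⊗[ℝ] V) : Submodule ℂ (ℂ ⊗[ℝ] V) :=
  Submodule.span ℂ {w | ∃ g ∈ groupC ρ, w = (g : Module.End ℂ (ℂ ⊗[ℝ] V)) v}

variable {P : Set (Module.Dual ℂ (complexify 𝔠))}

/-- `w_{α,ρ} = exp(ρ(X_α)) exp(-ρ(X_{-α})) exp(ρ(X_α))`. -/
def SimpleTriple.weylRho (ρ : 𝔤 →ₗ⁅ℝ⁆ Module.End ℝ V) (t : SimpleTriple 𝔤 𝔠 P) :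
    LinearMap.GeneralLinearGroup ℂ (ℂ ⊗[ℝ] V) :=
  expGL (rhoC ρ t.X) * expGL (-(rhoC ρ t.Y)) * expGL (rhoC ρ t.X)

/-- `ω_ρ = w_{β₁,ρ} ⋯ w_{β_l,ρ}` in `GL(V^ℂ)`. -/
def omegaRho (ρ : 𝔤 →ₗ⁅ℝ⁆ Module.End ℝ V) (s : List (SimpleTriple 𝔤 𝔠 P)) :
    LinearMap.GeneralLinearGroup ℂ (ℂ ⊗[ℝ] V) :=
  (s.map (SimpleTriple.weylRho ρ)).prod

end Rep

end RealRep

end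

set_option linter.unusedSectionVars false

/-! Let 2ρ be the sum of the positive roots. Conjugating the conditions on v shows that v̄ is a
highest weight vector of weight λ^σ for the positive system σ(R⁺). Two positive systems differ by a
word of reflections in simple roots of the first (`IsPositive.exists_word`), and ω lifts such a word
for the pair R⁺, σ(R⁺). Since the graph of ρ^ℂ is stable under conjugation by exponentials
(`intertwines_exp`), conjugation by ω_ρ matches conjugation by ω, with no need for a homomorphism of
groups. Hence w = ω_ρ⁻¹ v̄ is a highest weight vector for R⁺ (`isHighWeightVector_omegaRho_inv`).

The orbit span of v̄ is the smallest invariant subspace containing v̄. As ω_ρ and its inverse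
preserve every invariant subspace, it is also the smallest one containing w. What remains is that a
finite dimensional module generated by a highest weight vector is irreducible
(`IsHighest.eq_bot_or_mem`).

This is proved with the Casimir operator instead of complete reducibility. Let w have weight μ. A
nonzero submodule contains a highest weight vector, of weight ν say, and the Casimir operator acts
on the whole generated module by the scalar (μ, μ+2ρ). If the vector is not a multiple of w, then
μ−ν is a nonzero sum of positive roots, and dominance of μ and ν gives (μ, μ+2ρ) − (ν, ν+2ρ) =
(μ+ν+2ρ, μ−ν) > 0, a contradiction. -/

noncomputable section

/-! ### Positive systems in finite families of roots -/

section RootCombinatorics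

variable {E : Type*} [AddCommGroup E] [Module ℂ E]

/-- A finite reduced crystallographic family of roots `Φ`, with coroot functionals `c`. -/
structure IsRootFamily (Φ : Set E) (c : E → Module.Dual ℂ E) : Prop where
  finite : Φ.Finite
  ne_zero : ∀ α ∈ Φ, α ≠ 0
  neg_mem : ∀ α ∈ Φ, -α ∈ Φ
  coroot_self : ∀ α ∈ Φ, c α α = 2
  integral : ∀ α ∈ Φ, ∀ β ∈ Φ, ∃ k : ℤ, c α β = k
  reflection_mem : ∀ α ∈ Φ, ∀ β ∈ Φ, β - c α β • α ∈ Φ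
  sub_mem : ∀ α ∈ Φ, ∀ β ∈ Φ, α ≠ β → 0 < (c α β).re → β - α ∈ Φ
  add_self_notMem : ∀ α ∈ Φ, α + α ∉ Φ

/-- A positive system in a family of roots. -/
structure IsPositive (Φ P : Set E) : Prop where
  subset : P ⊆ Φ
  pos_or_neg : ∀ α ∈ Φ, α ∈ P ∨ -α ∈ P
  neg_notMem : ∀ α ∈ P, -α ∉ P
  closed : ∀ α ∈ P, ∀ β ∈ P, α + β ∈ Φ → α + β ∈ P

/-- An element of `P` which is not a sum of two elements of `P`. -/
def IsIndecomposable (P : Set E) (α : E) : Prop :=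
  α ∈ P ∧ ∀ β ∈ P, ∀ γ ∈ P, α ≠ β + γ

variable {Φ P : Set E} {c : E → Module.Dual ℂ E}

namespace IsRootFamily

lemma add_mem (hΦ : IsRootFamily Φ c) {α β : E} (hα : α ∈ Φ) (hβ : β ∈ Φ) (hne : β ≠ -α)
    (h : (c α β).re < 0) : α + β ∈ Φ := by
  have h1 := hΦ.sub_mem α hα (-β) (hΦ.neg_mem β hβ) (fun h' => hne (by rw [h', neg_neg]))
    (by simpa using h)
  have h2 := hΦ.neg_mem _ h1
  rwa [neg_sub, sub_neg_eq_add] at h2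

lemma reflection_self (hΦ : IsRootFamily Φ c) {α : E} (hα : α ∈ Φ) :
    Module.preReflection α (c α) α = -α := by
  rw [Module.preReflection_apply, hΦ.coroot_self α hα, two_smul]; abel

lemma reflection_reflection (hΦ : IsRootFamily Φ c) {α : E} (hα : α ∈ Φ) (x : E) :
    Module.preReflection α (c α) (Module.preReflection α (c α) x) = x :=
  Module.involutive_preReflection (hΦ.coroot_self α hα) x

lemma reflection_mem' (hΦ : IsRootFamily Φ c) {α β : E} (hα : α ∈ Φ) (hβ : β ∈ Φ) :
    Module.preReflection α (c α) β ∈ Φ := hΦ.reflection_mem α hα β hβ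

lemma preimage {E' : Type*} [AddCommGroup E'] [Module ℂ E'] (hΦ : IsRootFamily Φ c)
    (ψ : E' ≃ₗ[ℂ] E) :
    IsRootFamily (ψ ⁻¹' Φ) (fun α => (c (ψ α)).comp (ψ : E' →ₗ[ℂ] E)) where
  finite := hΦ.finite.preimage ψ.injective.injOn
  ne_zero := fun α hα h => hΦ.ne_zero _ hα (by rw [h, map_zero])
  neg_mem := fun α hα => by
    simpa only [Set.mem_preimage, map_neg] using hΦ.neg_mem _ hα
  coroot_self := fun α hα => hΦ.coroot_self _ hα
  integral := fun α hα β hβ => hΦ.integral _ hα _ hβ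
  reflection_mem := fun α hα β hβ => by
    simpa only [Set.mem_preimage, map_sub, map_smul, LinearMap.comp_apply, LinearEquiv.coe_coe] using hΦ.reflection_mem _ hα _ hβ
  sub_mem := fun α hα β hβ hne h => by
    simpa only [Set.mem_preimage, map_sub] using
      hΦ.sub_mem _ hα _ hβ (fun h' => hne (ψ.injective h')) h
  add_self_notMem := fun α hα => by
    simpa only [Set.mem_preimage, map_add] using hΦ.add_self_notMem _ hα

end IsRootFamily

namespace IsPositive

/-- Apply the coroot of one member a to the vanishing sum: a itself contributes 2, so some other
member b pairs negatively with a. Then a + b is a positive root, and merging the two gives a shorter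
multiset with the same sum. This replaces a linear functional that is positive on P. -/
theorem multiset_eq_zero (hP : IsPositive Φ P) (hΦ : IsRootFamily Φ c) :
    ∀ (n : ℕ) (s : Multiset E), s.card = n → (∀ x ∈ s, x ∈ P) → s.sum = 0 → s = 0 := by
  classical
  intro n
  induction n with
  | zero => intro s hs _ _; exact Multiset.card_eq_zero.mp hs
  | succ n ih =>
    intro s hs hsP hsum
    obtain ⟨a, t, rfl, ht⟩ := Multiset.card_eq_succ_iff.mp hs
    exfalso
    have ha : a ∈ P := hsP a (Multiset.mem_cons_self a t)
    rw [Multiset.sum_cons] at hsum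
    obtain ⟨b, hbt, hb⟩ : ∃ b ∈ t, (c a b).re < 0 := by
      by_contra! hcon
      have h1 : c a a + (t.map (c a)).sum = 0 := by
        rw [← map_multiset_sum, ← map_add, hsum, map_zero]
      rw [hΦ.coroot_self a (hP.subset ha)] at h1
      have h2 := congrArg Complex.re h1
      have h3 : ((t.map (c a)).sum).re = (t.map (fun b => (c a b).re)).sum := by
        rw [← Complex.coe_reAddGroupHom, map_multiset_sum, Multiset.map_map]; rfl
      have h4 : 0 ≤ (t.map (fun b => (c a b).re)).sum := by
        apply Multiset.sum_nonneg
        intro x hx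
        obtain ⟨b, hb, rfl⟩ := Multiset.mem_map.mp hx
        exact hcon b hb
      rw [Complex.add_re, h3] at h2
      simp at h2
      linarith
    obtain ⟨u, rfl⟩ := Multiset.exists_cons_of_mem hbt
    have hbP : b ∈ P := hsP b (by simp)
    have hab : a + b ∈ P := hP.closed a ha b hbP (hΦ.add_mem (hP.subset ha) (hP.subset hbP)
      (fun h => hP.neg_notMem a ha (h ▸ hbP)) hb)
    have := ih ((a + b) ::ₘ u) (by simpa using ht) (by
      intro x hx
      rcases Multiset.mem_cons.mp hx with rfl | hx
      · exact hab
      · exact hsP x (by simp [hx])) (by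
        rw [Multiset.sum_cons] at hsum ⊢
        rw [← hsum]; abel)
    exact Multiset.cons_ne_zero this

theorem add_ne_zero (hP : IsPositive Φ P) (hΦ : IsRootFamily Φ c) {a x : E} (ha : a ∈ P)
    (hx : x ∈ AddSubmonoid.closure P) : a + x ≠ 0 := by
  intro h
  obtain ⟨l, hl, rfl⟩ := AddSubmonoid.exists_multiset_of_mem_closure hx
  refine Multiset.cons_ne_zero (hP.multiset_eq_zero hΦ _ (a ::ₘ l) rfl ?_ (by simpa using h))
  intro y hy
  rcases Multiset.mem_cons.mp hy with rfl | hy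
  · exact ha
  · exact hl y hy

/-- This is the antisymmetry of the order whose nonnegative elements are the sums of positive roots.
-/
theorem eq_zero_of_neg_mem (hP : IsPositive Φ P) (hΦ : IsRootFamily Φ c) {x : E}
    (hx : x ∈ AddSubmonoid.closure P) (hx' : -x ∈ AddSubmonoid.closure P) : x = 0 := by
  obtain ⟨l, hl, rfl⟩ := AddSubmonoid.exists_multiset_of_mem_closure hx
  obtain ⟨m, hm, hlm⟩ := AddSubmonoid.exists_multiset_of_mem_closure hx'
  have := hP.multiset_eq_zero hΦ _ (l + m) rfl (by
    intro y hy
    rcases Multiset.mem_add.mp hy with hy | hy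
    · exact hl y hy
    · exact hm y hy) (by rw [Multiset.sum_add, hlm, add_neg_cancel])
  have hl0 := (add_eq_zero.mp this).1
  simp [hl0]

/-- Every nonempty finite set has an element that is minimal for the order defined by the monoid
generated by a positive system. -/
theorem exists_minimal (hP : IsPositive Φ P) (hΦ : IsRootFamily Φ c) {S : Set E} (hS : S.Finite)
    (hne : S.Nonempty) :
    ∃ x ∈ S, ∀ y ∈ S, x - y ∈ AddSubmonoid.closure P → y = x := by
  let le : E → E → Prop := fun y x => x - y ∈ AddSubmonoid.closure P
  let po : PartialOrder E :=
    { le := le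
      le_refl := fun x => by simp [le]
      le_trans := fun x y z hxy hyz => by
        have := (AddSubmonoid.closure P).add_mem hyz hxy
        simpa [le] using this
      le_antisymm := fun x y hxy hyx => by
        have := hP.eq_zero_of_neg_mem hΦ hxy (by simpa [le] using hyx)
        exact (sub_eq_zero.mp this).symm }
  obtain ⟨x, hx⟩ := hS.exists_minimal hne
  exact ⟨x, hx.1, fun y hy hxy => le_antisymm (show le y x from hxy) (hx.2 hy (show le y x from hxy))⟩

/-- Induction on the elements of a positive system. -/
theorem induction (hP : IsPositive Φ P) (hΦ : IsRootFamily Φ c) {p : E → Prop}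
    (simple : ∀ α, IsIndecomposable P α → p α)
    (add : ∀ β ∈ P, ∀ γ ∈ P, β + γ ∈ P → p β → p γ → p (β + γ)) {α : E} (hα : α ∈ P) : p α := by
  by_contra hp
  -- Take a minimal counterexample: if it decomposes, both summands are strictly smaller.
  obtain ⟨x, ⟨hxP, hx⟩, hmin⟩ := hP.exists_minimal hΦ (S := {x | x ∈ P ∧ ¬ p x})
    (hΦ.finite.subset fun x hx => hP.subset hx.1) ⟨α, hα, hp⟩
  by_cases hs : IsIndecomposable P x
  · exact hx (simple x hs)
  · simp only [IsIndecomposable, not_and, not_forall, not_not] at hs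
    obtain ⟨β, hβ, γ, hγ, rfl⟩ := hs hxP
    refine hx (add β hβ γ hγ hxP ?_ ?_)
    · by_contra h
      have := hmin β ⟨hβ, h⟩ (by simpa using AddSubmonoid.subset_closure hγ)
      exact hΦ.ne_zero γ (hP.subset hγ) (by simpa using this)
    · by_contra h
      have := hmin γ ⟨hγ, h⟩ (by simpa using AddSubmonoid.subset_closure hβ)
      exact hΦ.ne_zero β (hP.subset hβ) (by simpa using this)

/-- If β + γ = kα with k > 0, the coroot of α takes the value 2k on the sum, so one of β, γ pairs
positively with α. Subtracting α from it gives a root, which is positive because α is indecomposable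
and differs from α because 2α is not a root; this lowers k. -/
theorem add_ne_nsmul (hP : IsPositive Φ P) (hΦ : IsRootFamily Φ c) {α : E}
    (hα : IsIndecomposable P α) (k : ℕ) :
    ∀ β ∈ P, ∀ γ ∈ P, β ≠ α → γ ≠ α → β + γ ≠ k • α := by
  induction k with
  | zero =>
    intro β hβ γ hγ _ _ h
    exact hP.add_ne_zero hΦ hβ (AddSubmonoid.subset_closure hγ) (by simpa using h)
  | succ k ih =>
    have step : ∀ β ∈ P, ∀ γ ∈ P, β ≠ α → γ ≠ α → β + γ = (k + 1) • α → ¬ 0 < (c α β).re := by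
      intro β hβ γ hγ hβα hγα h hpos
      have h1 := hΦ.sub_mem α (hP.subset hα.1) β (hP.subset hβ) hβα.symm hpos
      have h2 : β - α ∈ P := by
        rcases hP.pos_or_neg _ h1 with h2 | h2
        · exact h2
        · exact absurd (by abel) (hα.2 β hβ _ h2)
      refine ih (β - α) h2 γ hγ ?_ hγα ?_
      · intro h3
        rw [sub_eq_iff_eq_add] at h3
        exact hΦ.add_self_notMem α (hP.subset hα.1) (h3 ▸ hP.subset hβ)
      · rw [add_smul, one_smul] at h
        rw [sub_add_eq_add_sub, h, add_sub_cancel_right]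
    intro β hβ γ hγ hβα hγα h
    have h1 := step β hβ γ hγ hβα hγα h
    have h2 := step γ hγ β hβ hγα hβα (by rw [add_comm, h])
    have h3 := congrArg (fun x => (c α x).re) h
    simp only [map_add, map_nsmul, hΦ.coroot_self α (hP.subset hα.1), Complex.add_re] at h3
    have h4 : ((k + 1) • (2 : ℂ)).re = (k + 1) * 2 := by simp
    rw [h4] at h3
    have : (0 : ℝ) ≤ k := Nat.cast_nonneg k
    linarith

/-- The reflection in a simple root `α` permutes the positive roots different from `α`. -/
theorem reflection_mem (hP : IsPositive Φ P) (hΦ : IsRootFamily Φ c) {α β : E}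
    (hα : IsIndecomposable P α) (hβ : β ∈ P) (hne : β ≠ α) :
    Module.preReflection α (c α) β ∈ P := by
  have hαΦ := hP.subset hα.1
  rcases hP.pos_or_neg _ (hΦ.reflection_mem' hαΦ (hP.subset hβ)) with h | h
  · exact h
  exfalso
  obtain ⟨k, hk⟩ := hΦ.integral α hαΦ β (hP.subset hβ)
  -- If the reflected root were negative, kα would be a sum of two positive roots. For k ≥ 0 the
  -- previous lemma excludes this; for k < 0, adding |k|α would give a vanishing sum of positive
  -- roots.
  have hsum : β + -(Module.preReflection α (c α) β) = k • α := by
    rw [Module.preReflection_apply, hk, Int.cast_smul_eq_zsmul]; abel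
  rcases le_or_gt 0 k with h0 | h0
  · lift k to ℕ using h0
    refine hP.add_ne_nsmul hΦ hα k β hβ _ h hne ?_ (by simpa using hsum)
    intro h1
    apply hne
    have := congrArg (Module.preReflection α (c α)) h1
    rw [map_neg, hΦ.reflection_reflection hαΦ, hΦ.reflection_self hαΦ] at this
    exact neg_injective this
  · refine hP.add_ne_zero hΦ hβ (x := -(Module.preReflection α (c α) β) + (-k).toNat • α)
      (add_mem (AddSubmonoid.subset_closure h)
        (nsmul_mem (AddSubmonoid.subset_closure hα.1) _)) ?_
    rw [← add_assoc, hsum, ← natCast_zsmul, Int.toNat_of_nonneg (by omega), ← add_smul]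
    simp

/-- Additivity is all that is asked of the map, so that this covers both the reflections and the
conjugate-linear map μ ↦ μ^σ. -/
theorem image_of_involutive {f : E →+ E} (hP : IsPositive Φ P) (hf : ∀ x, f (f x) = x)
    (hΦ : ∀ x ∈ Φ, f x ∈ Φ) : IsPositive Φ (f '' P) := by
  have hmem : ∀ x, x ∈ f '' P ↔ f x ∈ P := by
    intro x
    constructor
    · rintro ⟨y, hy, rfl⟩
      rwa [hf]
    · intro h
      exact ⟨_, h, hf x⟩
  refine ⟨?_, ?_, ?_, ?_⟩
  · rintro _ ⟨y, hy, rfl⟩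
    exact hΦ _ (hP.subset hy)
  · intro β hβ
    rw [hmem, hmem, map_neg]
    exact hP.pos_or_neg _ (hΦ _ hβ)
  · intro β hβ
    rw [hmem] at hβ ⊢
    rw [map_neg]
    exact hP.neg_notMem _ hβ
  · intro β hβ γ hγ h
    rw [hmem] at hβ hγ ⊢
    rw [map_add]
    exact hP.closed _ hβ _ hγ (by rw [← map_add]; exact hΦ _ h)

theorem image_reflection (hP : IsPositive Φ P) (hΦ : IsRootFamily Φ c) {α : E} (hα : α ∈ Φ) :
    IsPositive Φ (Module.preReflection α (c α) '' P) :=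
  hP.image_of_involutive (f := (Module.preReflection α (c α)).toAddMonoidHom)
    (hΦ.reflection_reflection hα) fun _ hx => hΦ.reflection_mem' hα hx

theorem preimage {E' : Type*} [AddCommGroup E'] [Module ℂ E'] (hP : IsPositive Φ P)
    (ψ : E' ≃ₗ[ℂ] E) : IsPositive (ψ ⁻¹' Φ) (ψ ⁻¹' P) where
  subset := fun x hx => hP.subset hx
  pos_or_neg := fun x hx => by
    simpa only [Set.mem_preimage, map_neg] using hP.pos_or_neg _ hx
  neg_notMem := fun x hx => by
    simpa only [Set.mem_preimage, map_neg] using hP.neg_notMem _ hx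
  closed := fun x hx y hy h => by
    simp only [Set.mem_preimage, map_add] at hx hy h ⊢
    exact hP.closed _ hx _ hy h

theorem eq_of_subset {P' : Set E} (hP : IsPositive Φ P) (hP' : IsPositive Φ P') (h : P ⊆ P') :
    P = P' := by
  refine h.antisymm fun x hx => ?_
  rcases hP.pos_or_neg x (hP'.subset hx) with h1 | h1
  · exact h1
  · exact absurd (h h1) (hP'.neg_notMem x hx)

/-- Any two positive systems are related by a product of reflections in simple roots of the
first one. -/
theorem exists_word (hP : IsPositive Φ P) (hΦ : IsRootFamily Φ c) {P' : Set E}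
    (hP' : IsPositive Φ P') :
    ∃ l : List E, (∀ α ∈ l, IsIndecomposable P α) ∧
      (fun x => (l.map fun α => Module.preReflection α (c α)).prod x) '' P = P' := by
  -- The induction is on the number of roots of P that are negative for P'. When every simple root
  -- of P lies in P', the two systems agree and the empty word works.
  induction hn : (P \ P').ncard using Nat.strong_induction_on generalizing P' with
  | _ n ih =>
    have hfin : P.Finite := hΦ.finite.subset hP.subset
    by_cases hsub : ∀ α, IsIndecomposable P α → α ∈ P'
    · refine ⟨[], by simp, ?_⟩
      have : P ⊆ P' := fun α hα => hP.induction hΦ (p := fun x => x ∈ P') hsub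
        (fun β _ γ _ h hβ' hγ' => hP'.closed β hβ' γ hγ' (hP.subset h)) hα
      simpa using hP.eq_of_subset hP' this
    · push Not at hsub
      obtain ⟨α, hα, hαP'⟩ := hsub
      have hαΦ := hP.subset hα.1
      set s := Module.preReflection α (c α) with hs
      -- The reflection s permutes P without α, so it embeds P \ s(P') into P \ P' and misses α.
      have hlt : (P \ (s '' P')).ncard < n := by
        have himg : s '' (P \ (s '' P')) ⊆ (P \ P') \ {α} := by
          rintro _ ⟨β, ⟨hβ, hβ'⟩, rfl⟩
          have hβα : β ≠ α := by
            rintro rfl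
            refine hβ' ⟨-β, (hP'.pos_or_neg β hαΦ).resolve_left hαP', ?_⟩
            rw [map_neg, hs, hΦ.reflection_self hαΦ, neg_neg]
          refine ⟨⟨hP.reflection_mem hΦ hα hβ hβα, fun h => hβ' ⟨_, h, ?_⟩⟩, fun h => ?_⟩
          · exact hΦ.reflection_reflection hαΦ β
          · have h1 : s β = α := h
            have h2 := congrArg s h1
            rw [hs, hΦ.reflection_reflection hαΦ, hΦ.reflection_self hαΦ] at h2
            exact hP.neg_notMem α hα.1 (h2 ▸ hβ)
        have hinj : Function.Injective s :=
          (Module.involutive_preReflection (hΦ.coroot_self α hαΦ)).injective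
        calc (P \ (s '' P')).ncard = (s '' (P \ (s '' P'))).ncard :=
              (Set.ncard_image_of_injective _ hinj).symm
          _ ≤ ((P \ P') \ {α}).ncard := Set.ncard_le_ncard himg (hfin.sdiff.sdiff)
          _ < (P \ P').ncard := Set.ncard_sdiff_singleton_lt_of_mem ⟨hα.1, hαP'⟩ hfin.sdiff
          _ = n := hn
      obtain ⟨l, hl, hl'⟩ := ih _ hlt (hP'.image_reflection hΦ hαΦ) rfl
      -- The word l carries P to s(P'), and s is an involution. All letters are simple for the fixed
      -- system P.
      refine ⟨α :: l, by simpa using ⟨hα, hl⟩, ?_⟩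
      have : (fun x => ((α :: l).map fun α => Module.preReflection α (c α)).prod x) '' P =
          s '' ((fun x => (l.map fun α => Module.preReflection α (c α)).prod x) '' P) := by
        rw [Set.image_image]; rfl
      rw [this, hl', Set.image_image]
      exact (Set.image_congr fun x _ => hΦ.reflection_reflection hαΦ x).trans (Set.image_id' P')

/-- The sum of the positive roots takes the value `2` at every simple coroot. -/
theorem coroot_sum (hP : IsPositive Φ P) (hΦ : IsRootFamily Φ c) {α : E}
    (hα : IsIndecomposable P α) (S : Finset E) (hS : ∀ x, x ∈ S ↔ x ∈ P) :
    c α (∑ γ ∈ S, γ) = 2 := by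
  classical
  have hαΦ := hP.subset hα.1
  have hαS : α ∈ S := (hS α).2 hα.1
  set s := Module.preReflection α (c α) with hs
  have hmem : ∀ x ∈ S.erase α, s x ∈ S.erase α := by
    intro x hx
    rw [Finset.mem_erase, hS] at hx ⊢
    refine ⟨fun h => ?_, hP.reflection_mem hΦ hα hx.2 hx.1⟩
    have h2 := congrArg s h
    rw [hs, hΦ.reflection_reflection hαΦ, hΦ.reflection_self hαΦ] at h2
    exact hP.neg_notMem α hα.1 (h2 ▸ hx.2)
  -- The reflection permutes the positive roots other than α, so it fixes their sum and the coroot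
  -- of α vanishes there; only α contributes.
  have h1 : s (∑ γ ∈ S.erase α, γ) = ∑ γ ∈ S.erase α, γ := by
    rw [map_sum]
    exact Finset.sum_bij' (fun x _ => s x) (fun x _ => s x) hmem hmem
      (fun x _ => hΦ.reflection_reflection hαΦ x) (fun x _ => hΦ.reflection_reflection hαΦ x)
      (fun x _ => rfl)
  have h2 : c α (∑ γ ∈ S.erase α, γ) = 0 := by
    rw [hs, Module.preReflection_apply, sub_eq_self, smul_eq_zero] at h1
    exact h1.resolve_right (hΦ.ne_zero α hαΦ)
  rw [← Finset.add_sum_erase S _ hαS, map_add, h2, hΦ.coroot_self α hαΦ, add_zero]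

end IsPositive

end RootCombinatorics

/-! ### Exponentials in finite dimensional normed algebras -/

section Exponential

open NormedSpace

variable {𝔸 : Type*} [NormedRing 𝔸] [NormedAlgebra ℂ 𝔸] [FiniteDimensional ℂ 𝔸]

/-- A subspace containing the image of all powers of `a` contains the image of `exp a`. -/
theorem exp_mem_of_pow_mem {F : Type*} [AddCommGroup F] [Module ℂ F] (φ : 𝔸 →ₗ[ℂ] F)
    (S : Submodule ℂ F) (a : 𝔸) (h : ∀ k : ℕ, φ (a ^ k) ∈ S) : φ (exp a) ∈ S := by
  have : CompleteSpace 𝔸 := FiniteDimensional.complete ℂ 𝔸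
  -- Subspaces of a finite dimensional space are closed, so membership passes to the limit of the
  -- partial sums.
  have hc : IsClosed ((S.comap φ : Submodule ℂ 𝔸) : Set 𝔸) := Submodule.closed_of_finiteDimensional _
  have hs := exp_series_hasSum_exp' (𝕂 := ℂ) a
  refine hc.mem_of_tendsto hs (Filter.Eventually.of_forall fun s => ?_)
  exact Submodule.sum_mem _ fun k _ => Submodule.smul_mem _ _ (h k)

/-- The identity exp(ad a) = Ad(exp a): left and right multiplications commute, so the exponential
of their difference factors. -/
theorem exp_mulLeft_sub_mulRight (a b : 𝔸) :
    exp (ContinuousLinearMap.mul ℂ 𝔸 a - (ContinuousLinearMap.mul ℂ 𝔸).flip a) b =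
      exp a * b * exp (-a) := by
  have : CompleteSpace 𝔸 := FiniteDimensional.complete ℂ 𝔸
  set L := ContinuousLinearMap.mul ℂ 𝔸 a
  set R := (ContinuousLinearMap.mul ℂ 𝔸).flip (-a)
  have hL : ∀ (k : ℕ) (x : 𝔸), (L ^ k) x = a ^ k * x := by
    intro k
    induction k with
    | zero => intro x; simp
    | succ k ih => intro x; rw [pow_succ, pow_succ, mul_apply_eq_comp, ih]; simp [L, mul_assoc]
  have hR : ∀ (k : ℕ) (x : 𝔸), (R ^ k) x = x * (-a) ^ k := by
    intro k
    induction k with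
    | zero => intro x; simp
    | succ k ih => intro x; rw [pow_succ, pow_succ', mul_apply_eq_comp, ih]; simp [R, mul_assoc]
  have eL : ∀ x, exp L x = exp a * x := by
    intro x
    have h1 := (exp_series_hasSum_exp' (𝕂 := ℂ) L).mapL (ContinuousLinearMap.apply ℂ 𝔸 x)
    have h2 := (exp_series_hasSum_exp' (𝕂 := ℂ) a).mul_right x
    have h3 : ∀ k : ℕ, ContinuousLinearMap.apply ℂ 𝔸 x ((k.factorial⁻¹ : ℂ) • L ^ k) =
        (k.factorial⁻¹ : ℂ) • a ^ k * x := fun k => by simp [hL]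
    simp only [h3] at h1
    exact h1.unique h2
  have eR : ∀ x, exp R x = x * exp (-a) := by
    intro x
    have h1 := (exp_series_hasSum_exp' (𝕂 := ℂ) R).mapL (ContinuousLinearMap.apply ℂ 𝔸 x)
    have h2 := (exp_series_hasSum_exp' (𝕂 := ℂ) (-a)).mul_left x
    have h3 : ∀ k : ℕ, ContinuousLinearMap.apply ℂ 𝔸 x ((k.factorial⁻¹ : ℂ) • R ^ k) =
        x * (k.factorial⁻¹ : ℂ) • (-a) ^ k := fun k => by
      rw [mul_smul_comm, ← hR]; rfl
    simp only [h3] at h1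
    exact h1.unique h2
  have hLR : Commute L R := by
    ext x; simp [L, R, mul_assoc]
  have hsum : L - (ContinuousLinearMap.mul ℂ 𝔸).flip a = L + R := by simp [R, sub_eq_add_neg]
  let : NormedAlgebra ℚ (𝔸 →L[ℂ] 𝔸) := NormedAlgebra.restrictScalars ℚ ℂ _
  rw [hsum, exp_add_of_commute hLR, mul_apply_eq_comp, eR, eL, mul_assoc]

/-- A subspace stable under `ad a` is stable under conjugation by `exp a`. -/
theorem exp_mul_mul_exp_neg_mem (S : Submodule ℂ 𝔸) (a : 𝔸) (h : ∀ x ∈ S, a * x - x * a ∈ S)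
    {b : 𝔸} (hb : b ∈ S) : exp a * b * exp (-a) ∈ S := by
  have : CompleteSpace 𝔸 := FiniteDimensional.complete ℂ 𝔸
  rw [← exp_mulLeft_sub_mulRight]
  set T := ContinuousLinearMap.mul ℂ 𝔸 a - (ContinuousLinearMap.mul ℂ 𝔸).flip a
  let φ : (𝔸 →L[ℂ] 𝔸) →ₗ[ℂ] 𝔸 := (ContinuousLinearMap.apply ℂ 𝔸 b).toLinearMap
  refine exp_mem_of_pow_mem φ S T fun k => ?_
  induction k with
  | zero => simpa [φ] using hb
  | succ k ih =>
    have : φ (T ^ (k + 1)) = a * φ (T ^ k) - φ (T ^ k) * a := by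
      simp only [pow_succ', φ]; rfl
    rw [this]
    exact h _ ih

/-- The third power of ad a kills b, so the series for exp(ad a) stops at the quadratic term. -/
theorem exp_mul_mul_exp_neg_eq {a b b₁ b₂ : 𝔸} (h₁ : a * b - b * a = b₁)
    (h₂ : a * b₁ - b₁ * a = b₂) (h₃ : a * b₂ - b₂ * a = 0) :
    exp a * b * exp (-a) = b + b₁ + (1 / 2 : ℂ) • b₂ := by
  have : CompleteSpace 𝔸 := FiniteDimensional.complete ℂ 𝔸
  rw [← exp_mulLeft_sub_mulRight]
  set T := ContinuousLinearMap.mul ℂ 𝔸 a - (ContinuousLinearMap.mul ℂ 𝔸).flip a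
  have hT : ∀ x, T x = a * x - x * a := fun x => rfl
  have hs := (exp_series_hasSum_exp' (𝕂 := ℂ) T).mapL (ContinuousLinearMap.apply ℂ 𝔸 b)
  have hk : ∀ k : ℕ, (T ^ (k + 3)) b = 0 := by
    intro k
    rw [pow_add]
    simp [pow_succ, hT, h₁, h₂, h₃]
  have h0 : ∀ k ∉ Finset.range 3,
      ContinuousLinearMap.apply ℂ 𝔸 b ((k.factorial⁻¹ : ℂ) • T ^ k) = 0 := by
    intro k hk'
    obtain ⟨j, rfl⟩ := Nat.exists_eq_add_of_le' (Nat.le_of_not_lt fun h => hk' (Finset.mem_range.2 h))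
    simp [hk]
  have := hs.unique (hasSum_sum_of_ne_finset_zero h0)
  rw [ContinuousLinearMap.apply_apply] at this
  rw [this]
  simp [Finset.sum_range_succ, hT, h₁, h₂, Nat.factorial]

/-- Conjugation in a product of algebras, in the form needed for S the graph of a representation. -/
theorem exp_mul_mul_exp_neg_mem_prod {𝔹 : Type*} [NormedRing 𝔹] [NormedAlgebra ℂ 𝔹]
    [FiniteDimensional ℂ 𝔹] (S : Submodule ℂ (𝔸 × 𝔹)) (a : 𝔸 × 𝔹)
    (h : ∀ x ∈ S, a * x - x * a ∈ S) {b : 𝔸 × 𝔹} (hb : b ∈ S) :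
    (exp a.1 * b.1 * exp (-a.1), exp a.2 * b.2 * exp (-a.2)) ∈ S := by
  have : CompleteSpace 𝔸 := FiniteDimensional.complete ℂ 𝔸
  have : CompleteSpace 𝔹 := FiniteDimensional.complete ℂ 𝔹
  let : NormedAlgebra ℚ 𝔸 := NormedAlgebra.restrictScalars ℚ ℂ _
  let : NormedAlgebra ℚ 𝔹 := NormedAlgebra.restrictScalars ℚ ℂ _
  have h1 := exp_mul_mul_exp_neg_mem S a h hb
  have h2 : exp a * b * exp (-a) =
      (exp a.1 * b.1 * exp (-a.1), exp a.2 * b.2 * exp (-a.2)) := by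
    ext <;> simp
  rwa [h2] at h1

/-- A subspace containing the image of `exp (z • a)` for all `z` contains the image of `a`. -/
theorem mem_of_exp_smul_mem {F : Type*} [AddCommGroup F] [Module ℂ F] (φ : 𝔸 →ₗ[ℂ] F)
    (S : Submodule ℂ F) (a : 𝔸) (h : ∀ z : ℂ, φ (exp (z • a)) ∈ S) : φ a ∈ S := by
  have : CompleteSpace 𝔸 := FiniteDimensional.complete ℂ 𝔸
  have hc : IsClosed ((S.comap φ : Submodule ℂ 𝔸) : Set 𝔸) := Submodule.closed_of_finiteDimensional _
  have hd := (hasDerivAt_exp_smul_const (𝕂 := ℂ) a 0).tendsto_slope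
  rw [zero_smul, exp_zero, one_mul] at hd
  refine hc.mem_of_tendsto hd (Filter.Eventually.of_forall fun z => ?_)
  rw [slope_def_module]
  exact Submodule.smul_mem _ _ (Submodule.sub_mem _ (h z) (h 0))

end Exponential

/-! ### Matrix exponentials and conjugation by Weyl group representatives -/

namespace RealRep

open scoped Matrix.Norms.Operator

section

variable {m n : ℕ}

/-- The operator norm on matrices is in scope only in this part; this statement and the following
ones are free of it. -/
theorem expMat_mem_of_pow_mem {F : Type*} [AddCommGroup F] [Module ℂ F]
    (φ : Matrix (Fin m) (Fin m) ℂ →ₗ[ℂ] F) (S : Submodule ℂ F) (a : Matrix (Fin m) (Fin m) ℂ)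
    (h : ∀ k : ℕ, φ (a ^ k) ∈ S) : φ (expMat a).val ∈ S :=
  exp_mem_of_pow_mem φ S a h

theorem mem_of_expMat_smul_mem {F : Type*} [AddCommGroup F] [Module ℂ F]
    (φ : Matrix (Fin m) (Fin m) ℂ →ₗ[ℂ] F) (S : Submodule ℂ F) (a : Matrix (Fin m) (Fin m) ℂ)
    (h : ∀ z : ℂ, φ (expMat (z • a)).val ∈ S) : φ a ∈ S :=
  mem_of_exp_smul_mem φ S a h

theorem expMat_inv (a : Matrix (Fin m) (Fin m) ℂ) : (expMat a)⁻¹ = expMat (-a) := by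
  ext1; rfl

theorem expMat_mul_mul_mem
    (S : Submodule ℂ (Matrix (Fin n) (Fin n) ℂ × Matrix (Fin m) (Fin m) ℂ))
    (a : Matrix (Fin n) (Fin n) ℂ × Matrix (Fin m) (Fin m) ℂ)
    (h : ∀ x ∈ S, a * x - x * a ∈ S)
    {b : Matrix (Fin n) (Fin n) ℂ × Matrix (Fin m) (Fin m) ℂ} (hb : b ∈ S) :
    ((expMat a.1).val * b.1 * (expMat (-a.1)).val,
      (expMat a.2).val * b.2 * (expMat (-a.2)).val) ∈ S :=
  exp_mul_mul_exp_neg_mem_prod S a h hb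

theorem expMat_conj_eq {a b b₁ b₂ : Matrix (Fin m) (Fin m) ℂ} (h₁ : a * b - b * a = b₁)
    (h₂ : a * b₁ - b₁ * a = b₂) (h₃ : a * b₂ - b₂ * a = 0) :
    (expMat a).val * b * (expMat (-a)).val = b + b₁ + (1 / 2 : ℂ) • b₂ :=
  exp_mul_mul_exp_neg_eq h₁ h₂ h₃

/-- The element `exp X exp (-Y) exp X` of an `𝔰𝔩₂`-triple acts as a reflection on the matrices
normalizing the lines of `X` and `Y`. -/
theorem weyl_conj {H X Y K : Matrix (Fin m) (Fin m) ℂ} (t : IsSl2Triple H X Y) {k : ℂ}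
    (hX : ⁅K, X⁆ = k • X) (hY : ⁅K, Y⁆ = -(k • Y)) :
    ((expMat X * expMat (-Y) * expMat X).val * K *
      ((expMat X * expMat (-Y) * expMat X)⁻¹).val) = K - k • H := by
  have hXY := t.lie_e_f
  have hHX := t.lie_h_e_smul ℂ
  have hHY := t.lie_lie_smul_f ℂ
  rw [Ring.lie_def] at hX hY hXY hHX hHY
  -- On K, H and X every series met here has at most three terms. The elementary conjugations are
  -- computed first and then composed.
  have e1 : (expMat X).val * K * (expMat (-X)).val = K - k • X := by
    rw [expMat_conj_eq (b₁ := -(k • X)) (b₂ := 0)]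
    · simp [sub_eq_add_neg]
    · rw [← hX]; abel
    · simp
    · simp
  have e2 : (expMat X).val * X * (expMat (-X)).val = X := by
    rw [expMat_conj_eq (b₁ := 0) (b₂ := 0)] <;> simp
  have e3 : (expMat X).val * H * (expMat (-X)).val = H - (2 : ℂ) • X := by
    rw [expMat_conj_eq (b₁ := -((2 : ℂ) • X)) (b₂ := 0)]
    · simp [sub_eq_add_neg]
    · rw [← hHX]; abel
    · simp
    · simp
  have e4 : (expMat (-Y)).val * K * (expMat Y).val = K - k • Y := by
    have := expMat_conj_eq (a := -Y) (b := K) (b₁ := -(k • Y)) (b₂ := 0)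
      (by rw [← hY]; noncomm_ring) (by simp) (by simp)
    rw [neg_neg] at this
    rw [this]; simp [sub_eq_add_neg]
  have e5 : (expMat (-Y)).val * X * (expMat Y).val = X + H - Y := by
    have := expMat_conj_eq (a := -Y) (b := X) (b₁ := H) (b₂ := -((2 : ℂ) • Y))
      (by rw [← hXY]; noncomm_ring) (by rw [← hHY]; noncomm_ring) (by simp)
    rw [neg_neg] at this
    rw [this, smul_neg, smul_smul]; norm_num [sub_eq_add_neg]
  have e : (expMat X * expMat (-Y) * expMat X)⁻¹ = expMat (-X) * expMat Y * expMat (-X) := by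
    rw [mul_inv_rev, mul_inv_rev, expMat_inv, expMat_inv, neg_neg, mul_assoc]
  rw [e]
  calc _ = (expMat X).val * ((expMat (-Y)).val * ((expMat X).val * K * (expMat (-X)).val) *
        (expMat Y).val) * (expMat (-X)).val := by simp only [Units.val_mul, mul_assoc]
    _ = K - k • H := by
      rw [e1, mul_sub, sub_mul, e4, mul_smul_comm, smul_mul_assoc, e5]
      have : K - k • Y - k • (X + H - Y) = K - k • X - k • H := by
        rw [smul_sub, smul_add]; abel
      rw [this, mul_sub, sub_mul, mul_sub, sub_mul, e1, mul_smul_comm, smul_mul_assoc,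
        mul_smul_comm, smul_mul_assoc, e2, e3, smul_sub, smul_smul, mul_comm k 2, mul_smul, two_smul]
      abel

end

end RealRep

namespace RealRep

/-! ### Exponentials of endomorphisms and stable subspaces -/

section ExpGL

variable {W : Type*} [AddCommGroup W] [Module ℂ W] [Module.Finite ℂ W]

theorem expGL_inv (T : Module.End ℂ W) : (expGL T)⁻¹ = expGL (-T) := by
  rw [expGL, expGL, ← map_inv, expMat_inv, map_neg]

theorem expGL_val (T : Module.End ℂ W) :
    (expGL T).val = (LinearMap.toMatrixAlgEquiv (Module.finBasis ℂ W)).symm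
      (expMat (LinearMap.toMatrixAlgEquiv (Module.finBasis ℂ W) T)).val := rfl

theorem expGL_val_apply (T : Module.End ℂ W) (w : W) :
    (expGL T).val w = (LinearMap.applyₗ w).comp
      (LinearMap.toMatrixAlgEquiv (Module.finBasis ℂ W)).symm.toLinearMap
      (expMat (LinearMap.toMatrixAlgEquiv (Module.finBasis ℂ W) T)).val := rfl

theorem expGL_apply_mem {T : Module.End ℂ W} {U : Submodule ℂ W} (h : ∀ w ∈ U, T w ∈ U) {w : W}
    (hw : w ∈ U) : (expGL T).val w ∈ U := by
  rw [expGL_val_apply]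
  refine expMat_mem_of_pow_mem _ U _ fun k => ?_
  simp only [LinearMap.comp_apply, ← map_pow, AlgEquiv.toLinearMap_apply,
    AlgEquiv.symm_apply_apply, LinearMap.applyₗ_apply_apply]
  induction k with
  | zero => simpa using hw
  | succ k ih => rw [pow_succ']; exact h _ ih

theorem apply_mem_of_expGL_smul_apply_mem {T : Module.End ℂ W} {U : Submodule ℂ W} {w : W}
    (h : ∀ z : ℂ, (expGL (z • T)).val w ∈ U) : T w ∈ U := by
  have := mem_of_expMat_smul_mem ((LinearMap.applyₗ w).comp
      (LinearMap.toMatrixAlgEquiv (Module.finBasis ℂ W)).symm.toLinearMap) U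
      (LinearMap.toMatrixAlgEquiv (Module.finBasis ℂ W) T) (fun z => by
        rw [← map_smul, ← expGL_val_apply]; exact h z)
  simpa using this

end ExpGL

/-! ### Conjugation compatible with a representation -/

section Compatible

variable {n : ℕ} {L : LieSubalgebra ℂ (Matrix (Fin n) (Fin n) ℂ)}
  {W : Type*} [AddCommGroup W] [Module ℂ W]

/-- Conjugation by `p.1` preserves `L`, and is intertwined by the representation `ρ` with
conjugation by `p.2`. -/
def Intertwines (ρ : L →ₗ⁅ℂ⁆ Module.End ℂ W)
    (p : Matrix.GeneralLinearGroup (Fin n) ℂ × LinearMap.GeneralLinearGroup ℂ W) : Prop :=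
  ∀ Z : L, ∃ Z' : L, p.1.val * Z * (p.1⁻¹).val = Z' ∧ p.2.val * ρ Z * (p.2⁻¹).val = ρ Z'

/-- The subgroup of all pairs that, together with their inverses, intertwine the representation. -/
def intertwiningSubgroup (ρ : L →ₗ⁅ℂ⁆ Module.End ℂ W) :
    Subgroup (Matrix.GeneralLinearGroup (Fin n) ℂ × LinearMap.GeneralLinearGroup ℂ W) where
  carrier := {p | Intertwines ρ p ∧ Intertwines ρ p⁻¹}
  one_mem' := by
    constructor <;> exact fun Z => ⟨Z, by simp⟩
  mul_mem' := by
    have key : ∀ p q, Intertwines ρ p → Intertwines ρ q → Intertwines ρ (p * q) := by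
      intro p q hp hq Z
      obtain ⟨Z₁, h₁, h₁'⟩ := hq Z
      obtain ⟨Z₂, h₂, h₂'⟩ := hp Z₁
      refine ⟨Z₂, ?_, ?_⟩
      · rw [← h₂, ← h₁]; simp only [Prod.fst_mul, mul_inv_rev, Units.val_mul, mul_assoc]
      · rw [← h₂', ← h₁']; simp only [Prod.snd_mul, mul_inv_rev, Units.val_mul, mul_assoc]
    intro p q hp hq
    refine ⟨key p q hp.1 hq.1, ?_⟩
    rw [mul_inv_rev]
    exact key _ _ hq.2 hp.2
  inv_mem' := by
    intro p hp
    exact ⟨hp.2, by rw [inv_inv]; exact hp.1⟩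

variable [Module.Finite ℂ W]

/-- The graph of ρ is a subspace of the product of two matrix algebras, stable under ad of (X, ρ X),
hence under conjugation by its exponential. Reading off the components gives one Z' that serves both
conjugations. -/
theorem intertwines_exp (ρ : L →ₗ⁅ℂ⁆ Module.End ℂ W) (X : L) :
    Intertwines ρ (expMat (X : Matrix (Fin n) (Fin n) ℂ), expGL (ρ X)) := by
  intro Z
  set Φ := LinearMap.toMatrixAlgEquiv (Module.finBasis ℂ W)
  let F : L →ₗ[ℂ] Matrix (Fin n) (Fin n) ℂ × Matrix _ _ ℂ :=
    LinearMap.prod L.toSubmodule.subtype (Φ.toLinearMap.comp (ρ : L →ₗ[ℂ] Module.End ℂ W))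
  have hF : ∀ Z : L, F Z = ((Z : Matrix (Fin n) (Fin n) ℂ), Φ (ρ Z)) := fun Z => rfl
  have hmem := expMat_mul_mul_mem (LinearMap.range F) (F X) (by
    rintro _ ⟨Z, rfl⟩
    refine ⟨⁅X, Z⁆, ?_⟩
    rw [hF, hF, hF, LieHom.map_lie, Ring.lie_def, map_sub, map_mul, map_mul]
    rfl) (LinearMap.mem_range_self F Z)
  obtain ⟨Z', hZ'⟩ := hmem
  rw [hF, hF, Prod.mk.injEq] at hZ'
  refine ⟨Z', ?_, ?_⟩
  · rw [hZ'.1, expMat_inv]; rfl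
  · have h2 := congrArg Φ.symm hZ'.2
    rw [AlgEquiv.symm_apply_apply] at h2
    simp only [hF, ← map_neg Φ] at h2
    rw [map_mul, map_mul, AlgEquiv.symm_apply_apply, ← expGL_val, ← expGL_val] at h2
    rw [expGL_inv]
    exact h2.symm

theorem exp_mem_intertwiningSubgroup (ρ : L →ₗ⁅ℂ⁆ Module.End ℂ W) (X : L) :
    (expMat (X : Matrix (Fin n) (Fin n) ℂ), expGL (ρ X)) ∈ intertwiningSubgroup ρ := by
  refine ⟨intertwines_exp ρ X, ?_⟩
  have := intertwines_exp ρ (-X)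
  rw [Prod.inv_mk, expMat_inv, expGL_inv, ← map_neg]
  exact this

end Compatible

/-! ### The orbit span as the smallest invariant subspace -/

section Orbit

variable {n : ℕ} {V : Type*} [AddCommGroup V] [Module ℝ V] [Module.Finite ℝ V]
  {𝔤 𝔠 : LieSubalgebra ℝ (Matrix (Fin n) (Fin n) ℝ)} {P : Set (Module.Dual ℂ (complexify 𝔠))}

theorem omega_mem_intertwiningSubgroup (ρ : 𝔤 →ₗ⁅ℝ⁆ Module.End ℝ V)
    (s : List (SimpleTriple 𝔤 𝔠 P)) :
    (omega s, omegaRho ρ s) ∈ intertwiningSubgroup (rhoC ρ) := by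
  induction s with
  | nil => exact one_mem _
  | cons t s ih =>
    have h1 := exp_mem_intertwiningSubgroup (rhoC ρ) t.X
    have h2 := exp_mem_intertwiningSubgroup (rhoC ρ) (-t.Y)
    rw [map_neg] at h2
    have := mul_mem (mul_mem (mul_mem h1 h2) h1) ih
    simpa [omega, omegaRho, SimpleTriple.weyl, SimpleTriple.weylRho] using! this

theorem rhoC_of_real (ρ : 𝔤 →ₗ⁅ℝ⁆ Module.End ℝ V) (Z : complexify 𝔤) (w : ℂ ⊗[ℝ] V) :
    rhoC ρ Z w = (ρ (rePart Z)).baseChange ℂ w + Complex.I • (ρ (imPart Z)).baseChange ℂ w := rfl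

/-- An element of a real Lie algebra, as an element of the complexification. -/
def ofReal (X : 𝔤) : complexify 𝔤 :=
  ⟨(X : Matrix (Fin n) (Fin n) ℝ).map Complex.ofReal, by
    constructor
    · convert X.2; ext i j; simp
    · convert 𝔤.zero_mem; ext i j; simp⟩

theorem rhoC_ofReal (ρ : 𝔤 →ₗ⁅ℝ⁆ Module.End ℝ V) (X : 𝔤) :
    rhoC ρ (ofReal X) = (ρ X).baseChange ℂ := by
  have h1 : rePart (ofReal X) = X := by ext i j; simp [rePart, ofReal]
  have h2 : imPart (ofReal X) = 0 := by ext i j; simp [imPart, ofReal]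
  ext w
  simp [rhoC_of_real, h1, h2]

theorem mem_orbitSpan (ρ : 𝔤 →ₗ⁅ℝ⁆ Module.End ℝ V) (v : ℂ ⊗[ℝ] V) : v ∈ orbitSpan ρ v :=
  Submodule.subset_span ⟨1, one_mem _, rfl⟩

theorem groupC_apply_mem_orbitSpan (ρ : 𝔤 →ₗ⁅ℝ⁆ Module.End ℝ V) {v w : ℂ ⊗[ℝ] V}
    {g : LinearMap.GeneralLinearGroup ℂ (ℂ ⊗[ℝ] V)} (hg : g ∈ groupC ρ) (hw : w ∈ orbitSpan ρ v) :
    g.val w ∈ orbitSpan ρ v := by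
  have : orbitSpan ρ v ≤ (orbitSpan ρ v).comap g.val := by
    refine Submodule.span_le.2 ?_
    rintro _ ⟨h, hh, rfl⟩
    exact Submodule.subset_span ⟨g * h, mul_mem hg hh, rfl⟩
  exact this hw

/-- Differentiate the one-parameter subgroups at the identity; the real algebra 𝔤 spans its
complexification. -/
theorem isInvariant_orbitSpan (ρ : 𝔤 →ₗ⁅ℝ⁆ Module.End ℝ V) (v : ℂ ⊗[ℝ] V) :
    IsInvariant ρ (orbitSpan ρ v) := by
  have key : ∀ (X : 𝔤), ∀ w ∈ orbitSpan ρ v, (ρ X).baseChange ℂ w ∈ orbitSpan ρ v :=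
    fun X w hw => apply_mem_of_expGL_smul_apply_mem fun z =>
      groupC_apply_mem_orbitSpan ρ (Subgroup.subset_closure ⟨z, X, rfl⟩) hw
  intro Z w hw
  rw [rhoC_of_real]
  exact add_mem (key _ w hw) (Submodule.smul_mem _ _ (key _ w hw))

/-- Exponentials of operators preserving U preserve U. The inverse is carried along so that the
induction over the generated subgroup closes. -/
theorem orbitSpan_le (ρ : 𝔤 →ₗ⁅ℝ⁆ Module.End ℝ V) {v : ℂ ⊗[ℝ] V} {U : Submodule ℂ (ℂ ⊗[ℝ] V)}
    (hU : IsInvariant ρ U) (hv : v ∈ U) : orbitSpan ρ v ≤ U := by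
  have key : ∀ g ∈ groupC ρ, ∀ w ∈ U, g.val w ∈ U ∧ (g⁻¹).val w ∈ U := by
    intro g hg
    induction hg using Subgroup.closure_induction with
    | mem g hg =>
      obtain ⟨z, X, rfl⟩ := hg
      have h1 : ∀ w ∈ U, (z • (ρ X).baseChange ℂ) w ∈ U := fun w hw => by
        rw [← rhoC_ofReal]; exact U.smul_mem _ (hU _ w hw)
      refine fun w hw => ⟨expGL_apply_mem h1 hw, ?_⟩
      rw [expGL_inv]
      exact expGL_apply_mem (fun w hw => U.neg_mem (h1 w hw)) hw
    | one => intro w hw; simpa using hw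
    | mul g h _ _ ihg ihh =>
      intro w hw
      rw [mul_inv_rev]
      exact ⟨(ihg _ (ihh w hw).1).1, (ihh _ (ihg w hw).2).2⟩
    | inv g _ ih =>
      intro w hw
      rw [inv_inv]
      exact (ih w hw).symm
  refine Submodule.span_le.2 ?_
  rintro _ ⟨g, hg, rfl⟩
  exact (key g hg v hv).1

/-- Consequently v̄ and ω_ρ⁻¹ v̄ lie in the same invariant subspaces. -/
theorem omegaRho_apply_mem (ρ : 𝔤 →ₗ⁅ℝ⁆ Module.End ℝ V) {U : Submodule ℂ (ℂ ⊗[ℝ] V)}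
    (hU : IsInvariant ρ U) (s : List (SimpleTriple 𝔤 𝔠 P)) :
    ∀ w ∈ U, (omegaRho ρ s).val w ∈ U ∧ ((omegaRho ρ s)⁻¹).val w ∈ U := by
  have hX : ∀ (Z : complexify 𝔤), ∀ w ∈ U, (expGL (rhoC ρ Z)).val w ∈ U :=
    fun Z w hw => expGL_apply_mem (hU Z) hw
  have hX' : ∀ (Z : complexify 𝔤), ∀ w ∈ U, (expGL (-(rhoC ρ Z))).val w ∈ U :=
    fun Z w hw => expGL_apply_mem (fun w hw => U.neg_mem (hU Z w hw)) hw
  induction s with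
  | nil => intro w hw; simpa [omegaRho] using hw
  | cons t s ih =>
    intro w hw
    have e : omegaRho ρ (t :: s) = t.weylRho ρ * omegaRho ρ s := by simp [omegaRho]
    have e' : (t.weylRho ρ)⁻¹ =
        expGL (-(rhoC ρ t.X)) * expGL (rhoC ρ t.Y) * expGL (-(rhoC ρ t.X)) := by
      rw [SimpleTriple.weylRho, mul_inv_rev, mul_inv_rev, expGL_inv, expGL_inv, neg_neg, mul_assoc]
    rw [e, mul_inv_rev, e', SimpleTriple.weylRho]
    simp only [Units.val_mul, Module.End.mul_apply]
    exact ⟨hX _ _ (hX' _ _ (hX _ _ (ih w hw).1)), (ih _ (hX' _ _ (hX _ _ (hX' _ _ hw)))).2⟩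

end Orbit

end RealRep

/-! ### Roots of a complex Lie algebra with nondegenerate Killing form -/

namespace LieAlgebra.IsKilling

open LieModule Module

variable {L : Type*} [LieRing L] [LieAlgebra ℂ L] [IsKilling ℂ L] [FiniteDimensional ℂ L]
  (H : LieSubalgebra ℂ L) [H.IsCartanSubalgebra]

/-- The roots of a Cartan subalgebra, as linear functionals. -/
def linearRoots : Set (Dual ℂ H) := {α | ∃ β : Weight ℂ H L, β.IsNonZero ∧ β.toLinear = α}

variable {H}

/-- The coroot of a linear functional on a Cartan subalgebra. -/
def linearCoroot (α : Dual ℂ H) : H :=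
  2 • (α ((cartanEquivDual H).symm α))⁻¹ • (cartanEquivDual H).symm α

lemma linearCoroot_toLinear (β : Weight ℂ H L) : linearCoroot β.toLinear = coroot β := rfl

lemma mem_linearRoots_iff {α : Dual ℂ H} :
    α ∈ linearRoots H ↔ α ≠ 0 ∧ rootSpace H (α : H → ℂ) ≠ ⊥ := by
  constructor
  · rintro ⟨β, hβ, rfl⟩
    exact ⟨by simpa using hβ, β.genWeightSpace_ne_bot⟩
  · rintro ⟨h0, h⟩
    exact ⟨⟨α, h⟩, fun hz => h0 (LinearMap.ext fun x => congrFun hz x), rfl⟩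

variable (H) in
lemma isRootFamily :
    IsRootFamily (linearRoots H) (fun α => Dual.eval ℂ H (linearCoroot α)) where
  finite := (Set.finite_range (fun β : Weight ℂ H L => β.toLinear)).subset (by
    rintro _ ⟨β, _, rfl⟩; exact ⟨β, rfl⟩)
  ne_zero := fun α hα => (mem_linearRoots_iff.1 hα).1
  neg_mem := by
    rintro _ ⟨β, hβ, rfl⟩
    exact ⟨-β, hβ.neg, rfl⟩
  coroot_self := by
    rintro _ ⟨β, hβ, rfl⟩
    exact root_apply_coroot hβ
  integral := by
    rintro _ ⟨α, hα, rfl⟩ _ ⟨β, hβ, rfl⟩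
    exact ⟨_, apply_coroot_eq_cast α β⟩
  reflection_mem := by
    rintro _ ⟨α, hα, rfl⟩ _ ⟨β, hβ, rfl⟩
    exact ⟨reflectRoot α β, reflectRoot_isNonZero α β hβ, rfl⟩
  sub_mem := by
    rintro _ ⟨α, hα, rfl⟩ _ ⟨β, hβ, rfl⟩ hne hpos
    have hα' : α ∈ H.root := by simpa using hα
    have hβ' : β ∈ H.root := by simpa using hβ
    have h1 : 0 < (rootSystem H).pairingIn ℤ ⟨β, hβ'⟩ ⟨α, hα'⟩ := by
      have h2 : (((rootSystem H).pairingIn ℤ ⟨β, hβ'⟩ ⟨α, hα'⟩ : ℤ) : ℂ) = β (coroot α) :=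
        (rootSystem H).algebraMap_pairingIn ℤ ⟨β, hβ'⟩ ⟨α, hα'⟩
      have h3 : 0 < (β (coroot α)).re := hpos
      rw [← h2, Complex.intCast_re] at h3
      exact_mod_cast h3
    obtain ⟨γ, hγ⟩ := RootPairing.root_sub_root_mem_of_pairingIn_pos _ h1 (by
      intro h; exact hne (by rw [Subtype.ext_iff] at h; exact congrArg _ h.symm))
    exact ⟨γ.1, H.isNonZero_coe_root γ, hγ⟩
  add_self_notMem := by
    rintro _ ⟨α, hα, rfl⟩ h
    have := (mem_linearRoots_iff.1 h).2
    rw [← two_smul ℕ] at this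
    exact this (rootSpace_two_smul α hα)

/-- With t dual to α and q = α(t) = κ(t, t), the Killing form is the sum of β(t)² over the roots.
Since t = (q/2)α^∨ and each β(α^∨) is an integer m_β, this reads q = (q²/4)N with N = ∑ m_β². So q
is real and positive, which supplies positivity over ℂ. -/
lemma exists_pos_smul_linearCoroot {α : Dual ℂ H} (hα : α ∈ linearRoots H) :
    ∃ r : ℝ, 0 < r ∧ (cartanEquivDual H).symm α = (r : ℂ) • linearCoroot α := by
  obtain ⟨α, hα, rfl⟩ := hα
  set t := (cartanEquivDual H).symm α.toLinear with ht
  set q := α t with hq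
  have hq0 : q ≠ 0 := root_apply_cartanEquivDual_symm_ne_zero hα
  have h1 : t = (q / 2) • coroot α := by
    change t = (q / 2) • (2 • q⁻¹ • t)
    rw [← Nat.cast_smul_eq_nsmul ℂ, smul_smul, smul_smul]
    simp [hq0]
  have h2 : killingForm ℂ L t t = q := by
    have : cartanEquivDual H t = α.toLinear := LinearEquiv.apply_symm_apply _ _
    exact LinearMap.congr_fun this t
  have h3 : killingForm ℂ L t t = ∑ β ∈ H.root, β t * β t := by
    have := LinearMap.congr_fun₂ (restrict_killingForm_eq_sum (H := H)) t t
    simpa using! this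
  choose m hm using fun β : Weight ℂ H L => (⟨_, apply_coroot_eq_cast α β⟩ : ∃ k : ℤ, β (coroot α) = k)
  have h4 : ∀ β : Weight ℂ H L, β t * β t = q ^ 2 / 4 * ((m β ^ 2 : ℤ) : ℂ) := by
    intro β
    have : β t = q / 2 * m β := by
      conv_lhs => rw [h1]
      rw [← Weight.toLinear_apply, map_smul, Weight.toLinear_apply, hm, smul_eq_mul]
    rw [this]; push_cast; ring
  rw [h2, Finset.sum_congr rfl fun β _ => h4 β, ← Finset.mul_sum, ← Int.cast_sum] at h3
  set N := ∑ β ∈ H.root, m β ^ 2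
  have hN0 : 0 ≤ N := Finset.sum_nonneg fun _ _ => sq_nonneg _
  have hN : (N : ℂ) ≠ 0 := by
    intro h; rw [h, mul_zero] at h3; exact hq0 h3
  have hNpos : 0 < (N : ℝ) := by
    have : N ≠ 0 := by exact_mod_cast hN
    exact_mod_cast lt_of_le_of_ne hN0 this.symm
  -- From q = 4/N the factor q/2 is 2/N.
  refine ⟨2 / N, by positivity, ?_⟩
  rw [linearCoroot_toLinear]
  refine h1.trans ?_
  congr 1
  push_cast
  field_simp
  field_simp at h3
  linear_combination -h3

/-! ### The Casimir operator -/

section Casimir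

/-- Families that are dual with respect to the Killing form. -/
def IsDualFamily {ι : Type*} [Fintype ι] (b b' : ι → L) : Prop :=
  ∀ y : L, ∑ i, killingForm ℂ L y (b' i) • b i = y

/-- Pairing the expansion of z with y gives the reverse expansion of y up to the kernel of the
Killing form, which is zero. -/
lemma IsDualFamily.symm {ι : Type*} [Fintype ι] {b b' : ι → L} (hb : IsDualFamily b b') :
    IsDualFamily b' b := by
  intro y
  refine sub_eq_zero.1 ((killingForm_nondegenerate ℂ L).1 _ fun z => ?_)
  have h := congrArg (killingForm ℂ L y) (hb z)
  rw [map_sub, LinearMap.sub_apply, sub_eq_zero, ← h]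
  simp only [map_sum, LinearMap.sum_apply, map_smul, LinearMap.smul_apply, smul_eq_mul]
  refine Finset.sum_congr rfl fun i _ => ?_
  rw [mul_comm, traceForm_comm ℂ L L (b' i) z]

/-- The Casimir tensor is invariant. -/
lemma IsDualFamily.sum_lie_eq_zero {ι : Type*} [Fintype ι] {b b' : ι → L} (hb : IsDualFamily b b')
    {A : Type*} [AddCommGroup A] [Module ℂ A] (f : L →ₗ[ℂ] L →ₗ[ℂ] A) (x : L) :
    ∑ i, (f ⁅x, b i⁆ (b' i) + f (b i) ⁅x, b' i⁆) = 0 := by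
  have h1 : ∀ i, f ⁅x, b i⁆ (b' i) = ∑ j, killingForm ℂ L ⁅x, b i⁆ (b' j) • f (b j) (b' i) := by
    intro i
    conv_lhs => rw [← hb ⁅x, b i⁆]
    simp
  have h2 : ∀ j, f (b j) ⁅x, b' j⁆ = ∑ i, killingForm ℂ L ⁅x, b' j⁆ (b i) • f (b j) (b' i) := by
    intro j
    conv_lhs => rw [← hb.symm ⁅x, b' j⁆]
    simp
  rw [Finset.sum_add_distrib, Finset.sum_congr rfl fun i _ => h1 i,
    Finset.sum_congr rfl fun j _ => h2 j, Finset.sum_comm, ← Finset.sum_add_distrib]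
  refine Finset.sum_eq_zero fun j _ => ?_
  rw [← Finset.sum_add_distrib]
  refine Finset.sum_eq_zero fun i _ => ?_
  -- After both brackets are expanded, the coefficients cancel in pairs by invariance of the Killing
  -- form.
  rw [← add_smul, traceForm_apply_lie_apply', traceForm_comm ℂ L L (b i), neg_add_cancel, zero_smul]

variable {W : Type*} [AddCommGroup W] [Module ℂ W] [LieRingModule L W] [LieModule ℂ L W]

/-- The Casimir operator of a pair of dual families. -/
def casimir {ι : Type*} [Fintype ι] (b b' : ι → L) : Module.End ℂ W :=
  ∑ i, toEnd ℂ L W (b i) * toEnd ℂ L W (b' i)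

lemma casimir_lie {ι : Type*} [Fintype ι] {b b' : ι → L} (hb : IsDualFamily b b') (x : L) (w : W) :
    casimir b b' ⁅x, w⁆ = ⁅x, casimir b b' w⁆ := by
  let f : L →ₗ[ℂ] L →ₗ[ℂ] Module.End ℂ W :=
    (LinearMap.mul ℂ (Module.End ℂ W)).compl₁₂ (toEnd ℂ L W : L →ₗ[ℂ] Module.End ℂ W)
      (toEnd ℂ L W : L →ₗ[ℂ] Module.End ℂ W)
  have h := LinearMap.congr_fun (hb.sum_lie_eq_zero f x) w
  have h' : ∀ y z, f y z w = ⁅y, ⁅z, w⁆⁆ := fun y z => rfl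
  simp only [LinearMap.sum_apply, LinearMap.add_apply, h', LinearMap.zero_apply] at h
  simp only [casimir, LinearMap.sum_apply, Module.End.mul_apply, toEnd_apply_apply, lie_sum]
  rw [eq_comm, ← sub_eq_zero, ← Finset.sum_sub_distrib, ← h]
  refine Finset.sum_congr rfl fun i _ => ?_
  rw [leibniz_lie x (b i), leibniz_lie x (b' i), lie_add]
  abel

end Casimir

end LieAlgebra.IsKilling

/-! ### Casimir eigenvalues at highest weight vectors -/

namespace LieAlgebra.IsKilling

open LieModule Module

variable {L : Type*} [LieRing L] [LieAlgebra ℂ L] [IsKilling ℂ L] [FiniteDimensional ℂ L]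
  {H : LieSubalgebra ℂ L} [H.IsCartanSubalgebra]

lemma exists_rootVectors (α : H.root) :
    ∃ e f : L, e ∈ rootSpace H (α : Weight ℂ H L) ∧ f ∈ rootSpace H (-(α : Weight ℂ H L) : H → ℂ) ∧
      killingForm ℂ L e f = 1 ∧ ⁅e, f⁆ = (cartanEquivDual H).symm (α : Weight ℂ H L).toLinear := by
  obtain ⟨e, he, he₀⟩ := (α : Weight ℂ H L).exists_ne_zero
  obtain ⟨f, hfα, hf⟩ : ∃ f ∈ rootSpace H (-(α : Weight ℂ H L) : H → ℂ), killingForm ℂ L e f ≠ 0 := by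
    contrapose! he₀
    simpa using mem_ker_killingForm_of_mem_rootSpace_of_forall_rootSpace_neg ℂ L H he he₀
  have h1 : killingForm ℂ L e ((killingForm ℂ L e f)⁻¹ • f) = 1 := by
    rw [map_smul, smul_eq_mul, inv_mul_cancel₀ hf]
  have hfα' := (rootSpace H (-(α : Weight ℂ H L) : H → ℂ)).smul_mem (killingForm ℂ L e f)⁻¹ hfα
  refine ⟨e, _, he, hfα', h1, ?_⟩
  rw [lie_eq_killingForm_smul_of_mem_rootSpace_of_mem_rootSpace_neg he hfα', h1, one_smul]

variable (H)

/-- A root vector for each root. -/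
def rootVector (α : H.root) : L := (exists_rootVectors α).choose

/-- A root vector for the negative of each root, normalized by the Killing form. -/
def negRootVector (α : H.root) : L := (exists_rootVectors α).choose_spec.choose

lemma rootVector_mem (α : H.root) : rootVector H α ∈ rootSpace H (α : Weight ℂ H L) :=
  (exists_rootVectors α).choose_spec.choose_spec.1

lemma negRootVector_mem (α : H.root) :
    negRootVector H α ∈ rootSpace H (-(α : Weight ℂ H L) : H → ℂ) :=
  (exists_rootVectors α).choose_spec.choose_spec.2.1

lemma killingForm_rootVector (α : H.root) :
    killingForm ℂ L (rootVector H α) (negRootVector H α) = 1 :=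
  (exists_rootVectors α).choose_spec.choose_spec.2.2.1

lemma lie_rootVector (α : H.root) : ⁅rootVector H α, negRootVector H α⁆ =
    (cartanEquivDual H).symm (α : Weight ℂ H L).toLinear :=
  (exists_rootVectors α).choose_spec.choose_spec.2.2.2

/-- A basis of a Cartan subalgebra together with the root vectors. -/
def cartanFamily : Fin (finrank ℂ H) ⊕ H.root → L :=
  Sum.elim (fun i => (finBasis ℂ H i : L)) (rootVector H)

/-- The family dual to `cartanFamily`. -/
def cartanFamily' : Fin (finrank ℂ H) ⊕ H.root → L :=
  Sum.elim (fun i => ((cartanEquivDual H).symm ((finBasis ℂ H).coord i) : L)) (negRootVector H)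

lemma killingForm_cartanEquivDual_symm (μ : Dual ℂ H) (y : H) :
    killingForm ℂ L ((cartanEquivDual H).symm μ : H) y = μ y := by
  have : cartanEquivDual H ((cartanEquivDual H).symm μ) = μ := LinearEquiv.apply_symm_apply _ _
  exact LinearMap.congr_fun this y

/-- Root spaces of α and β are orthogonal unless α + β = 0, so the identity can be checked on one
root space at a time. On the Cartan subalgebra it is the expansion in a basis; on a nonzero root
space it holds because the space is a line. -/
lemma isDualFamily : IsDualFamily (cartanFamily H) (cartanFamily' H) := by
  intro y
  have hy : y ∈ ⨆ χ : H → ℂ, rootSpace H χ := by rw [iSup_genWeightSpace_eq_top ℂ H L]; trivial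
  have hh : ∀ i, ((cartanEquivDual H).symm ((finBasis ℂ H).coord i) : L) ∈ rootSpace H (0 : H → ℂ) := by
    intro i; rw [rootSpace_zero_eq]; exact Subtype.property _
  simp only [Fintype.sum_sum_type, cartanFamily, cartanFamily', Sum.elim_inl, Sum.elim_inr]
  induction hy using LieSubmodule.iSup_induction' with
  | mem χ y hy =>
    by_cases hy0 : y = 0
    · simp [hy0]
    by_cases hχ : χ = 0
    · subst hχ
      have hyH : y ∈ H := by simpa using hy
      have h2 : ∀ α : H.root, killingForm ℂ L y (negRootVector H α) = 0 := fun α =>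
        killingForm_apply_eq_zero_of_mem_rootSpace_of_add_ne_zero ℂ L H hy (negRootVector_mem H α)
          (by rw [zero_add, neg_ne_zero]; exact H.isNonZero_coe_root α)
      simp only [h2, zero_smul, Finset.sum_const_zero, add_zero]
      have h3 := congrArg (fun z : H => (z : L)) ((finBasis ℂ H).sum_repr ⟨y, hyH⟩)
      simp only [AddSubmonoidClass.coe_finsetSum, SetLike.val_smul] at h3
      conv_rhs => rw [← h3]
      refine Finset.sum_congr rfl fun i _ => ?_
      rw [traceForm_comm, killingForm_cartanEquivDual_symm H _ ⟨y, hyH⟩]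
      rfl
    · have h1 : ∀ i, killingForm ℂ L y
          ((cartanEquivDual H).symm ((finBasis ℂ H).coord i) : L) = 0 := fun i =>
        killingForm_apply_eq_zero_of_mem_rootSpace_of_add_ne_zero ℂ L H hy (hh i) (by simpa using hχ)
      simp only [h1, zero_smul, Finset.sum_const_zero, zero_add]
      let χ' : Weight ℂ H L := ⟨χ, fun h => hy0 (by rw [rootSpace, h] at hy; simpa using hy)⟩
      have hχ' : χ'.IsNonZero := hχ
      let α : H.root := ⟨χ', by simpa using hχ'⟩
      have he0 : rootVector H α ≠ 0 := by
        intro h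
        have := killingForm_rootVector H α
        rw [h] at this; simp at this
      obtain ⟨k, hk⟩ := (finrank_eq_one_iff_of_nonzero' (⟨rootVector H α, rootVector_mem H α⟩ :
          rootSpace H χ') (by simpa using he0)).mp (finrank_rootSpace_eq_one χ' hχ') ⟨y, hy⟩
      have hk' : y = k • rootVector H α := by simpa using! (congrArg Subtype.val hk).symm
      rw [Finset.sum_eq_single α]
      · conv_lhs => rw [hk', map_smul, LinearMap.smul_apply, killingForm_rootVector, smul_eq_mul,
          mul_one]
        exact hk'.symm
      · intro β _ hβ
        rw [killingForm_apply_eq_zero_of_mem_rootSpace_of_add_ne_zero ℂ L H hy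
          (negRootVector_mem H β), zero_smul]
        intro h
        apply hβ
        rw [← sub_eq_add_neg, sub_eq_zero] at h
        exact Subtype.ext (DFunLike.ext _ _ fun x => (congrFun h x).symm)
      · simp
  | zero => simp
  | add a b _ _ ha hb =>
    conv_rhs => rw [← ha, ← hb]
    simp only [map_add, LinearMap.add_apply, add_smul, Finset.sum_add_distrib]
    abel

variable {H}

variable {W : Type*} [AddCommGroup W] [Module ℂ W] [LieRingModule L W] [LieModule ℂ L W]

/-- `v` is a nonzero vector of weight `μ` that is killed by the root spaces of `P`. -/
structure IsHighest (P : Set (Dual ℂ H)) (v : W) (μ : Dual ℂ H) : Prop where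
  ne_zero : v ≠ 0
  nil : ∀ α ∈ P, ∀ e ∈ rootSpace H (α : H → ℂ), ⁅e, v⁆ = 0
  weight : ∀ h : H, ⁅(h : L), v⁆ = μ h • v

variable {P : Set (Dual ℂ H)}

open Classical in
/-- The eigenvalue of the Casimir operator at a highest weight vector of weight `μ`. -/
def casimirScalar (P : Set (Dual ℂ H)) (μ : Dual ℂ H) : ℂ :=
  μ ((cartanEquivDual H).symm μ) +
    ∑ α : H.root, if (α : Weight ℂ H L).toLinear ∈ P then
      μ ((cartanEquivDual H).symm (α : Weight ℂ H L).toLinear) else 0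

/-- For a positive root, e f v = [e, f] v because e v = 0; for a negative root, f already kills v.
With the Cartan part this gives the scalar (μ, μ + 2ρ). -/
lemma casimir_apply (hP : IsPositive (linearRoots H) P) {v : W} {μ : Dual ℂ H}
    (hv : IsHighest P v μ) :
    casimir (cartanFamily H) (cartanFamily' H) v = casimirScalar P μ • v := by
  classical
  simp only [casimir, LinearMap.sum_apply, LinearMap.add_apply, Module.End.mul_apply, toEnd_apply_apply,
    Fintype.sum_sum_type, cartanFamily, cartanFamily', Sum.elim_inl, Sum.elim_inr, casimirScalar,
    add_smul, Finset.sum_smul]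
  congr 1
  · have h1 : ∀ i, ⁅((finBasis ℂ H i : H) : L),
        ⁅((cartanEquivDual H).symm ((finBasis ℂ H).coord i) : L), v⁆⁆ =
        ((finBasis ℂ H).repr ((cartanEquivDual H).symm μ) i * μ (finBasis ℂ H i)) • v := by
      intro i
      rw [hv.weight, lie_smul, hv.weight, smul_smul, ← killingForm_cartanEquivDual_symm H μ,
        traceForm_comm, killingForm_cartanEquivDual_symm]
      rfl
    rw [Finset.sum_congr rfl fun i _ => h1 i, ← Finset.sum_smul]
    congr 1
    simpa only [map_sum, map_smul, smul_eq_mul] using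
      congrArg μ ((finBasis ℂ H).sum_repr ((cartanEquivDual H).symm μ))
  · refine Finset.sum_congr rfl fun α _ => ?_
    have hα : (α : Weight ℂ H L).toLinear ∈ linearRoots H := ⟨_, H.isNonZero_coe_root α, rfl⟩
    split_ifs with h
    · rw [leibniz_lie, lie_rootVector, hv.weight, hv.nil _ h _ (rootVector_mem H α), lie_zero,
        add_zero]
    · have h' := (hP.pos_or_neg _ hα).resolve_left h
      rw [hv.nil _ h' _ (negRootVector_mem H α), lie_zero, zero_smul]

lemma cartanEquivDual_symm_comm (μ ν : Dual ℂ H) :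
    μ ((cartanEquivDual H).symm ν) = ν ((cartanEquivDual H).symm μ) := by
  rw [← killingForm_cartanEquivDual_symm H μ, traceForm_comm, killingForm_cartanEquivDual_symm]

/-- Highest weights are dominant integral: v is a primitive vector for the 𝔰𝔩₂ attached to α. -/
lemma exists_nat_coroot [FiniteDimensional ℂ W] (hP : IsPositive (linearRoots H) P) {v : W}
    {μ : Dual ℂ H} (hv : IsHighest P v μ) {α : Dual ℂ H} (hα : α ∈ P) :
    ∃ n : ℕ, μ (linearCoroot α) = n := by
  obtain ⟨β, hβ, rfl⟩ := hP.subset hα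
  obtain ⟨h, e, f, t, he, hf⟩ := exists_isSl2Triple_of_weight_isNonZero hβ
  obtain rfl := t.h_eq_coroot hβ he hf
  have : t.HasPrimitiveVectorWith v (μ (coroot β)) :=
    ⟨hv.ne_zero, hv.weight _, hv.nil _ hα e he⟩
  exact this.exists_nat

/-- The Casimir operator distinguishes highest weights that differ by a nonzero sum of positive
roots. -/
theorem eq_of_casimirScalar_eq [FiniteDimensional ℂ W] (hP : IsPositive (linearRoots H) P)
    {v w : W} {μ ν : Dual ℂ H} (hv : IsHighest P v μ) (hw : IsHighest P w ν)
    (hmem : μ - ν ∈ AddSubmonoid.closure P) (h : casimirScalar P μ = casimirScalar P ν) :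
    μ = ν := by
  classical
  have hΦ := isRootFamily H
  have hfin : P.Finite := hΦ.finite.subset hP.subset
  -- Here ρ is the full sum of the positive roots, not half of it.
  set ρ : Dual ℂ H := ∑ γ ∈ hfin.toFinset, γ with hρ
  have hscalar : ∀ κ : Dual ℂ H, casimirScalar P κ =
      κ ((cartanEquivDual H).symm κ) + κ ((cartanEquivDual H).symm ρ) := by
    intro κ
    rw [casimirScalar, hρ, map_sum, map_sum, ← Finset.sum_filter]
    congr 1
    refine Finset.sum_bij (fun α _ => (α : Weight ℂ H L).toLinear) ?_ ?_ ?_ ?_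
    · intro α hα; simpa using hα
    · intro α _ β _ hαβ
      exact Subtype.ext (DFunLike.ext _ _ fun x => LinearMap.congr_fun hαβ x)
    · intro γ hγ
      have hγP : γ ∈ P := by simpa using hγ
      obtain ⟨β, hβ, rfl⟩ := hP.subset hγP
      exact ⟨⟨β, by simpa using hβ⟩, by simpa using hγP, rfl⟩
    · intro _ _; rfl
  -- The difference of the two Casimir scalars is F(μ − ν). On a simple root F is a positive
  -- multiple of m + k + 2, with m, k ≥ 0 by dominance and 2 the value of the sum of positive roots
  -- at a simple coroot. So F is positive on every nonzero sum of positive roots.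
  let F : Dual ℂ H →ₗ[ℂ] ℂ := (μ + ν + ρ).comp ((cartanEquivDual H).symm : Dual ℂ H →ₗ[ℂ] H)
  have hF : ∀ κ, F κ = μ ((cartanEquivDual H).symm κ) + ν ((cartanEquivDual H).symm κ) +
      ρ ((cartanEquivDual H).symm κ) := fun κ => rfl
  have hF0 : F (μ - ν) = 0 := by
    rw [hscalar, hscalar] at h
    rw [map_sub, hF, hF]
    rw [cartanEquivDual_symm_comm ρ μ, cartanEquivDual_symm_comm ρ ν,
      cartanEquivDual_symm_comm ν μ]
    linear_combination h
  have hpos : ∀ α ∈ P, ∃ x : ℝ, 0 < x ∧ F α = x := by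
    intro α hα
    refine hP.induction hΦ (p := fun α => ∃ x : ℝ, 0 < x ∧ F α = x) ?_ ?_ hα
    · intro α hα
      obtain ⟨r, hr, hr'⟩ := exists_pos_smul_linearCoroot (hP.subset hα.1)
      obtain ⟨m, hm⟩ := exists_nat_coroot hP hv hα.1
      obtain ⟨k, hk⟩ := exists_nat_coroot hP hw hα.1
      have h2 : ρ (linearCoroot α) = 2 := hP.coroot_sum hΦ hα hfin.toFinset (by simp)
      refine ⟨r * (m + k + 2), by positivity, ?_⟩
      rw [hF, hr', map_smul, map_smul, map_smul, hm, hk, h2]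
      push_cast
      simp only [smul_eq_mul]
      ring
    · rintro β _ γ _ _ ⟨x, hx, hx'⟩ ⟨y, hy, hy'⟩
      exact ⟨x + y, add_pos hx hy, by rw [map_add, hx', hy', Complex.ofReal_add]⟩
  have hcl : ∀ κ ∈ AddSubmonoid.closure P, κ = 0 ∨ ∃ x : ℝ, 0 < x ∧ F κ = x := by
    intro κ hκ
    induction hκ using AddSubmonoid.closure_induction with
    | mem κ hκ => exact Or.inr (hpos κ hκ)
    | zero => exact Or.inl rfl
    | add a b _ _ ha hb =>
      rcases ha with rfl | ⟨x, hx, hx'⟩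
      · rwa [zero_add]
      rcases hb with rfl | ⟨y, hy, hy'⟩
      · rw [add_zero]; exact Or.inr ⟨x, hx, hx'⟩
      · exact Or.inr ⟨x + y, add_pos hx hy, by rw [map_add, hx', hy', Complex.ofReal_add]⟩
  rcases hcl _ hmem with h0 | ⟨x, hx, hx'⟩
  · exact sub_eq_zero.1 h0
  · rw [hF0] at hx'
    exact absurd (by exact_mod_cast hx'.symm) hx.ne'

end LieAlgebra.IsKilling

/-! ### Modules generated by a highest weight vector -/

namespace LieAlgebra.IsKilling

open LieModule Module

variable {L : Type*} [LieRing L] [LieAlgebra ℂ L] [IsKilling ℂ L] [FiniteDimensional ℂ L]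
  {H : LieSubalgebra ℂ L} [H.IsCartanSubalgebra]
  {W : Type*} [AddCommGroup W] [Module ℂ W] [LieRingModule L W] [LieModule ℂ L W]
  {P : Set (Dual ℂ H)}

variable (W) in
/-- The space of vectors of weight `μ`. -/
def weightVectors (μ : Dual ℂ H) : Submodule ℂ W := (weightSpace W (μ : H → ℂ)).toSubmodule

lemma mem_weightVectors {μ : Dual ℂ H} {w : W} :
    w ∈ weightVectors W μ ↔ ∀ h : H, ⁅(h : L), w⁆ = μ h • w := by
  simp [weightVectors, mem_weightSpace]

variable (H W) in
lemma iSupIndep_weightVectors : iSupIndep (weightVectors W : Dual ℂ H → Submodule ℂ W) := by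
  have h1 := LieSubmodule.iSupIndep_toSubmodule.mpr (iSupIndep_genWeightSpace ℂ H W)
  have h2 : Function.Injective (fun μ : Dual ℂ H => (μ : H → ℂ)) := DFunLike.coe_injective
  exact (h1.comp h2).mono fun μ => weightSpace_le_genWeightSpace W _

lemma lie_mem_weightVectors {α : H → ℂ} {μ ν : Dual ℂ H} {e : L} (he : e ∈ rootSpace H α)
    (hν : ∀ h, ν h = α h + μ h) {w : W} (hw : w ∈ weightVectors W μ) :
    ⁅e, w⁆ ∈ weightVectors W ν := by
  rw [mem_weightVectors] at hw ⊢
  intro h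
  have h1 : ⁅(h : L), e⁆ = α h • e := lie_eq_smul_of_mem_rootSpace he h
  rw [leibniz_lie, h1, smul_lie, hw, lie_smul, ← add_smul, hν]

/-- The smallest subspace containing `v` that is stable under the negative root spaces. -/
def lowerSpan (P : Set (Dual ℂ H)) (v : W) : Submodule ℂ W :=
  sInf {U | v ∈ U ∧ ∀ α ∈ P, ∀ f ∈ rootSpace H (-α : H → ℂ), ∀ u ∈ U, ⁅f, u⁆ ∈ U}

lemma mem_lowerSpan_self (v : W) : v ∈ lowerSpan P v := by
  simp only [lowerSpan, Submodule.mem_sInf]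
  exact fun U hU => hU.1

lemma lie_mem_lowerSpan {v u : W} {α : Dual ℂ H} (hα : α ∈ P) {f : L}
    (hf : f ∈ rootSpace H (-α : H → ℂ)) (hu : u ∈ lowerSpan P v) : ⁅f, u⁆ ∈ lowerSpan P v := by
  simp only [lowerSpan, Submodule.mem_sInf] at hu ⊢
  exact fun U hU => hU.2 α hα f hf u (hu U hU)

lemma lowerSpan_le {v : W} {U : Submodule ℂ W} (hv : v ∈ U)
    (hU : ∀ α ∈ P, ∀ f ∈ rootSpace H (-α : H → ℂ), ∀ u ∈ U, ⁅f, u⁆ ∈ U) : lowerSpan P v ≤ U :=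
  sInf_le ⟨hv, hU⟩

variable {v : W} {μ : Dual ℂ H}

/-- The negative root spaces generate the whole module from a highest weight vector. -/
theorem IsHighest.lie_mem_lowerSpan (hP : IsPositive (linearRoots H) P) (hv : IsHighest P v μ)
    (x : L) {u : W} (hu : u ∈ lowerSpan P v) : ⁅x, u⁆ ∈ lowerSpan P v := by
  -- The vectors of the lower span that all of L keeps inside it. They include v and, by the Leibniz
  -- rule, are stable under negative root vectors, hence exhaust the lower span.
  let U : Submodule ℂ W :=
    { carrier := {u | u ∈ lowerSpan P v ∧ ∀ x : L, ⁅x, u⁆ ∈ lowerSpan P v}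
      add_mem' := fun ha hb => ⟨add_mem ha.1 hb.1, fun x => by
        rw [lie_add]; exact add_mem (ha.2 x) (hb.2 x)⟩
      zero_mem' := ⟨zero_mem _, fun x => by rw [lie_zero]; exact zero_mem _⟩
      smul_mem' := fun c a ha => ⟨Submodule.smul_mem _ c ha.1, fun x => by
        rw [lie_smul]; exact Submodule.smul_mem _ c (ha.2 x)⟩ }
  have hU : lowerSpan P v ≤ U := by
    refine lowerSpan_le ⟨mem_lowerSpan_self v, fun x => ?_⟩ ?_
    · have hx : x ∈ ⨆ χ : H → ℂ, rootSpace H χ := by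
        rw [iSup_genWeightSpace_eq_top ℂ H L]; trivial
      induction hx using LieSubmodule.iSup_induction' with
      | mem χ x hx =>
        by_cases hx0 : x = 0
        · rw [hx0, zero_lie]; exact zero_mem _
        by_cases hχ : χ = 0
        · subst hχ
          have hxH : x ∈ H := by simpa using hx
          rw [hv.weight ⟨x, hxH⟩]
          exact Submodule.smul_mem _ _ (mem_lowerSpan_self v)
        · let χ' : Weight ℂ H L := ⟨χ, fun h => hx0 (by rw [rootSpace, h] at hx; simpa using hx)⟩
          have hχ' : χ'.IsNonZero := hχ
          rcases hP.pos_or_neg χ'.toLinear ⟨χ', hχ', rfl⟩ with h | h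
          · rw [hv.nil _ h x hx]; exact zero_mem _
          · refine LieAlgebra.IsKilling.lie_mem_lowerSpan h (f := x) ?_ (mem_lowerSpan_self v)
            convert hx using 2
            ext y; simp [χ']
      | zero => rw [zero_lie]; exact zero_mem _
      | add a b _ _ ha hb => rw [add_lie]; exact add_mem ha hb
    · intro α hα f hf u hu
      refine ⟨LieAlgebra.IsKilling.lie_mem_lowerSpan hα hf hu.1, fun x => ?_⟩
      rw [leibniz_lie]
      exact add_mem (hu.2 _) (LieAlgebra.IsKilling.lie_mem_lowerSpan hα hf (hu.2 x))
  exact (hU hu).2 x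

/-- Negative root vectors strictly lower weights, so the lower span lies in ℂv plus the weight
spaces strictly below μ. Independence of weight spaces then places any weight vector in one of the
two parts. -/
theorem IsHighest.eq_smul_or_sub_mem (hP : IsPositive (linearRoots H) P) (hv : IsHighest P v μ)
    {w : W} {ν : Dual ℂ H} (hw : w ∈ lowerSpan P v) (hw0 : w ≠ 0) (hwν : w ∈ weightVectors W ν) :
    (∃ c : ℂ, w = c • v) ∨ (ν ≠ μ ∧ μ - ν ∈ AddSubmonoid.closure P) := by
  have hΦ := isRootFamily H
  let Q : Set (Dual ℂ H) := {κ | κ ≠ μ ∧ μ - κ ∈ AddSubmonoid.closure P}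
  have hvμ : v ∈ weightVectors W μ := mem_weightVectors.2 hv.weight
  have hle : lowerSpan P v ≤ Submodule.span ℂ {v} ⊔ ⨆ κ ∈ Q, weightVectors W κ := by
    refine lowerSpan_le (le_sup_left (a := Submodule.span ℂ {v})
      (Submodule.mem_span_singleton_self v)) ?_
    intro α hα f hf
    have hα0 := hΦ.ne_zero α (hP.subset hα)
    set T := Submodule.span ℂ {v} ⊔ ⨆ κ ∈ Q, weightVectors W κ with hT
    have hstep : ∀ κ : Dual ℂ H, μ - κ ∈ AddSubmonoid.closure P →
        weightVectors W κ ≤ T.comap (toEnd ℂ L W f) := by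
      intro κ hκ u hu
      have h1 : ⁅f, u⁆ ∈ weightVectors W (κ - α) :=
        lie_mem_weightVectors hf (fun h => by simp; ring) hu
      have h2 : κ - α ∈ Q := by
        refine ⟨fun h => hP.add_ne_zero hΦ hα hκ ?_, ?_⟩
        · rw [← h]; abel
        · have := add_mem hκ (AddSubmonoid.subset_closure hα)
          rwa [show μ - κ + α = μ - (κ - α) by abel] at this
      exact le_sup_right (a := Submodule.span ℂ {v})
        ((le_iSup₂_of_le (f := fun κ (_ : κ ∈ Q) => weightVectors W κ) _ h2 le_rfl) h1)
    have : T ≤ T.comap (toEnd ℂ L W f) := by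
      refine sup_le ?_ (iSup₂_le fun κ hκ => hstep κ hκ.2)
      rw [Submodule.span_singleton_le_iff_mem]
      exact hstep μ (by simp) hvμ
    exact fun u hu => this hu
  obtain ⟨y, hy, z, hz, rfl⟩ := Submodule.mem_sup.1 (hle hw)
  obtain ⟨c, rfl⟩ := Submodule.mem_span_singleton.1 hy
  have hind := iSupIndep_weightVectors H W ν
  by_cases hνQ : ν ∈ Q
  · exact Or.inr hνQ
  left
  have hz' : z ∈ ⨆ κ, ⨆ (_ : κ ≠ ν), weightVectors W κ :=
    (iSup₂_le fun κ hκ => le_iSup₂_of_le (f := fun κ (_ : κ ≠ ν) => weightVectors W κ) κ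
      (fun h => hνQ (h ▸ hκ)) le_rfl) hz
  by_cases hνμ : ν = μ
  · subst hνμ
    have h1 : z ∈ weightVectors W ν := by
      have := sub_mem hwν (Submodule.smul_mem _ c hvμ)
      rwa [add_sub_cancel_left] at this
    refine ⟨c, ?_⟩
    rw [Submodule.disjoint_def.1 hind z h1 hz', add_zero]
  · exfalso
    refine hw0 (Submodule.disjoint_def.1 hind _ hwν (add_mem (Submodule.smul_mem _ c ?_) hz'))
    exact (le_iSup₂_of_le (f := fun κ (_ : κ ≠ ν) => weightVectors W κ) μ (Ne.symm hνμ) le_rfl) hvμ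

variable [FiniteDimensional ℂ W]

/-- A nonzero submodule contains a highest weight vector. -/
theorem exists_isHighest (hP : IsPositive (linearRoots H) P) (N : LieSubmodule ℂ L W)
    (hN : N ≠ ⊥) : ∃ w ∈ N, ∃ ν : Dual ℂ H, IsHighest P w ν := by
  have hΦ := isRootFamily H
  let S : Set (Dual ℂ H) := {ν | ∃ w ∈ N, w ≠ 0 ∧ w ∈ weightVectors W ν}
  have hSfin : S.Finite := by
    refine (WellFoundedGT.finite_ne_bot_of_iSupIndep (iSupIndep_weightVectors H W)).subset ?_
    rintro ν ⟨w, _, hw0, hw⟩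
    exact fun h => hw0 (by rw [h] at hw; simpa using hw)
  have hSne : S.Nonempty := by
    have : Nontrivial N := (LieSubmodule.nontrivial_iff_ne_bot ℂ L W).2 hN
    obtain ⟨χ, hχ⟩ := exists_nontrivial_weightSpace_of_isNilpotent (k := ℂ) (L := H) (M := N)
    obtain ⟨w, hw⟩ := exists_ne (0 : weightSpace N χ)
    have h1 := (mem_weightSpace (M := N) χ (w : N)).1 w.2
    refine ⟨χ, (w : N), (w : N).2, ?_, mem_weightVectors.2 fun h => ?_⟩
    · simpa using hw
    · exact congrArg (fun z : N => (z : W)) (h1 h)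
  -- Negation turns the minimal element into a maximal weight; positive root vectors would raise it.
  obtain ⟨x, ⟨ν, ⟨w, hwN, hw0, hw⟩, rfl⟩, hmin⟩ :=
    hP.exists_minimal hΦ (hSfin.image Neg.neg) (hSne.image Neg.neg)
  refine ⟨w, hwN, ν, hw0, fun α hα e he => ?_, mem_weightVectors.1 hw⟩
  by_contra h0
  have h1 : α + ν ∈ S := ⟨_, N.lie_mem hwN, h0, lie_mem_weightVectors he (fun h => rfl) hw⟩
  have h2 := hmin _ ⟨_, h1, rfl⟩ (by
    have : -ν - -(α + ν) = α := by abel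
    rw [this]; exact AddSubmonoid.subset_closure hα)
  exact hΦ.ne_zero α (hP.subset hα) (by simpa using neg_injective h2)

/-- A finite dimensional module generated by a highest weight vector is irreducible. -/
theorem IsHighest.eq_bot_or_mem (hP : IsPositive (linearRoots H) P) (hv : IsHighest P v μ)
    (U : LieSubmodule ℂ L W) (hU : ∀ N : LieSubmodule ℂ L W, v ∈ N → U ≤ N)
    (N : LieSubmodule ℂ L W) (hN : N ≤ U) : N = ⊥ ∨ v ∈ N := by
  by_cases hN0 : N = ⊥
  · exact Or.inl hN0
  right
  obtain ⟨w, hwN, ν, hw⟩ := exists_isHighest hP N hN0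
  let M : LieSubmodule ℂ L W :=
    { lowerSpan P v with lie_mem := fun {x u} hu => hv.lie_mem_lowerSpan hP x hu }
  have hwM : w ∈ lowerSpan P v := hU M (mem_lowerSpan_self v) (hN hwN)
  rcases hv.eq_smul_or_sub_mem hP hwM hw.ne_zero (mem_weightVectors.2 hw.weight) with
    ⟨c, rfl⟩ | ⟨hne, hmem⟩
  · have hc : c ≠ 0 := fun h => hw.ne_zero (by rw [h, zero_smul])
    have := N.smul_mem c⁻¹ hwN
    rwa [smul_smul, inv_mul_cancel₀ hc, one_smul] at this
  · exfalso
    -- The Casimir eigenspace for the scalar of μ is a submodule containing v, so it contains U and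
    -- in particular w.
    let C : LieSubmodule ℂ L W :=
      { LinearMap.ker (casimir (cartanFamily H) (cartanFamily' H) -
          casimirScalar P μ • (1 : Module.End ℂ W)) with
        lie_mem := fun {x u} hu => by
          have hu' : casimir (cartanFamily H) (cartanFamily' H) u = casimirScalar P μ • u :=
            sub_eq_zero.1 hu
          change _ - casimirScalar P μ • ⁅x, u⁆ = 0
          rw [casimir_lie (isDualFamily H), hu', lie_smul, sub_self] }
    have hwC : w ∈ C := hU C (sub_eq_zero.2 (casimir_apply hP hv)) (hN hwN)
    have h1 : casimir (cartanFamily H) (cartanFamily' H) w = casimirScalar P μ • w :=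
      sub_eq_zero.1 hwC
    rw [casimir_apply hP hw] at h1
    have h2 := smul_left_injective ℂ hw.ne_zero h1
    exact hne (eq_of_casimirScalar_eq hP hv hw hmem h2.symm).symm

end LieAlgebra.IsKilling

namespace RealRep

open LieAlgebra Module

variable {n : ℕ} {𝔤 𝔠 : LieSubalgebra ℝ (Matrix (Fin n) (Fin n) ℝ)}

/-! ### The Killing form of the complexification -/

theorem eq_ofReal_add (Z : complexify 𝔤) :
    Z = ofReal (rePart Z) + Complex.I • ofReal (imPart Z) := by
  ext i j
  simp [ofReal, rePart, imPart, mul_comm Complex.I]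

/-- Extension of scalars from `𝔤` to its complexification. -/
def ofRealLinear (𝔤 : LieSubalgebra ℝ (Matrix (Fin n) (Fin n) ℝ)) : 𝔤 →ₗ[ℝ] complexify 𝔤 where
  toFun := ofReal
  map_add' X Y := by ext i j; simp [ofReal]
  map_smul' r X := by ext i j; simp [ofReal]

theorem ofReal_lie (X Y : 𝔤) : ofReal ⁅X, Y⁆ = ⁅ofReal X, ofReal Y⁆ := by
  ext i j
  simp [ofReal, Ring.lie_def, Matrix.mul_apply]

theorem rePart_ofReal (X : 𝔤) : rePart (ofReal X) = X := by ext i j; simp [rePart, ofReal]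

theorem imPart_ofReal (X : 𝔤) : imPart (ofReal X) = 0 := by ext i j; simp [imPart, ofReal]

theorem rePart_smul (c : ℂ) (Z : complexify 𝔤) :
    rePart (c • Z) = c.re • rePart Z - c.im • imPart Z := by
  ext i j; simp [rePart, imPart]

theorem imPart_smul (c : ℂ) (Z : complexify 𝔤) :
    imPart (c • Z) = c.re • imPart Z + c.im • rePart Z := by
  ext i j; simp [rePart, imPart]

theorem rePart_add (Z Z' : complexify 𝔤) : rePart (Z + Z') = rePart Z + rePart Z' := by
  ext i j; simp [rePart]

theorem imPart_add (Z Z' : complexify 𝔤) : imPart (Z + Z') = imPart Z + imPart Z' := by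
  ext i j; simp [imPart]

/-- The complexification is the extension of scalars. -/
def baseChangeEquiv (𝔤 : LieSubalgebra ℝ (Matrix (Fin n) (Fin n) ℝ)) :
    (ℂ ⊗[ℝ] 𝔤) ≃ₗ[ℂ] complexify 𝔤 :=
  let f : (ℂ ⊗[ℝ] 𝔤) →ₗ[ℂ] complexify 𝔤 :=
    TensorProduct.AlgebraTensorModule.lift
      ((LinearMap.toSpanSingleton ℂ (𝔤 →ₗ[ℝ] complexify 𝔤) (ofRealLinear 𝔤)))
  { f with
    invFun := fun Z => 1 ⊗ₜ rePart Z + Complex.I ⊗ₜ imPart Z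
    left_inv := by
      intro x
      change (1 : ℂ) ⊗ₜ[ℝ] rePart (f x) + Complex.I ⊗ₜ[ℝ] imPart (f x) = x
      induction x using TensorProduct.induction_on with
      | zero =>
        have h1 : rePart (0 : complexify 𝔤) = 0 := by ext i j; simp [rePart]
        have h2 : imPart (0 : complexify 𝔤) = 0 := by ext i j; simp [imPart]
        rw [map_zero, h1, h2]; simp
      | tmul z X =>
        have h : f (z ⊗ₜ X) = z • ofReal X := rfl
        rw [h, rePart_smul, imPart_smul, rePart_ofReal, imPart_ofReal, smul_zero, smul_zero,
          sub_zero, zero_add, ← TensorProduct.smul_tmul, ← TensorProduct.smul_tmul,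
          ← TensorProduct.add_tmul]
        congr 1
        conv_rhs => rw [← Complex.re_add_im z]
        simp
      | add x y hx hy =>
        rw [map_add, rePart_add, imPart_add, TensorProduct.tmul_add, TensorProduct.tmul_add]
        conv_rhs => rw [← hx, ← hy]
        abel
    right_inv := by
      intro Z
      change f _ = Z
      rw [map_add]
      have h : ∀ z X, f (z ⊗ₜ X) = z • ofReal X := fun z X => rfl
      rw [h, h, one_smul, ← eq_ofReal_add] }

theorem baseChangeEquiv_tmul (z : ℂ) (X : 𝔤) : baseChangeEquiv 𝔤 (z ⊗ₜ X) = z • ofReal X := rfl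

/-- The adjoint operators of the complexification are base changes of the real ones, and the trace
commutes with base change. -/
theorem killingForm_ofReal (X Y : 𝔤) :
    killingForm ℂ (complexify 𝔤) (ofReal X) (ofReal Y) = (killingForm ℝ 𝔤 X Y : ℂ) := by
  rw [killingForm_apply_apply, killingForm_apply_apply]
  have h : ad ℂ (complexify 𝔤) (ofReal X) ∘ₗ ad ℂ (complexify 𝔤) (ofReal Y) =
      (baseChangeEquiv 𝔤).conj ((ad ℝ 𝔤 X ∘ₗ ad ℝ 𝔤 Y).baseChange ℂ) := by
    have h1 : (ad ℂ (complexify 𝔤) (ofReal X) ∘ₗ ad ℂ (complexify 𝔤) (ofReal Y)) ∘ₗ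
        (baseChangeEquiv 𝔤).toLinearMap =
        (baseChangeEquiv 𝔤).toLinearMap ∘ₗ (ad ℝ 𝔤 X ∘ₗ ad ℝ 𝔤 Y).baseChange ℂ := by
      refine TensorProduct.AlgebraTensorModule.curry_injective ?_
      ext1
      ext1 Z
      simp [baseChangeEquiv_tmul, ofReal_lie]
    ext1 Z
    have h2 := LinearMap.congr_fun h1 ((baseChangeEquiv 𝔤).symm Z)
    simpa [LinearEquiv.conj_apply_apply] using h2
  rw [h, LinearMap.trace_conj', LinearMap.trace_baseChange]
  rfl

instance isKilling_complexify [IsKilling ℝ 𝔤] : IsKilling ℂ (complexify 𝔤) := by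
  constructor
  rw [eq_bot_iff]
  intro Z hZ
  have h0 : ∀ W, killingForm ℂ (complexify 𝔤) Z W = 0 := by
    intro W
    rw [LieModule.traceForm_comm]
    exact (LieIdeal.mem_killingCompl ℂ (complexify 𝔤) ⊤).mp hZ W (LieSubmodule.mem_top W)
  have h1 : ∀ A : 𝔤, killingForm ℝ 𝔤 (rePart Z) A = 0 ∧ killingForm ℝ 𝔤 (imPart Z) A = 0 := by
    intro A
    have h2 := h0 (ofReal A)
    rw [eq_ofReal_add Z, map_add, map_smul, LinearMap.add_apply, LinearMap.smul_apply,
      killingForm_ofReal, killingForm_ofReal] at h2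
    have h3 := congrArg Complex.re h2
    have h4 := congrArg Complex.im h2
    simp at h3 h4
    exact ⟨h3, h4⟩
  have hre := (IsKilling.killingForm_nondegenerate ℝ 𝔤).1 _ fun A => (h1 A).1
  have him := (IsKilling.killingForm_nondegenerate ℝ 𝔤).1 _ fun A => (h1 A).2
  rw [LieSubmodule.mem_bot, eq_ofReal_add Z, hre, him]
  ext i j; simp [ofReal]

/-! ### The complexified Cartan subalgebra -/

theorem complexify_mono (h : 𝔠 ≤ 𝔤) : complexify 𝔠 ≤ complexify 𝔤 := fun _ hZ => ⟨h hZ.1, h hZ.2⟩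

/-- The complexified Cartan subalgebra, inside the complexification. -/
def cartanC (𝔤 𝔠 : LieSubalgebra ℝ (Matrix (Fin n) (Fin n) ℝ)) :
    LieSubalgebra ℂ (complexify 𝔤) := (complexify 𝔠).comap (complexify 𝔤).incl

theorem IsCartan.lie_eq_zero (h𝔠 : IsCartan 𝔤 𝔠) {A B : Matrix (Fin n) (Fin n) ℂ}
    (hA : A ∈ complexify 𝔠) (hB : B ∈ complexify 𝔠) : ⁅A, B⁆ = 0 := by
  have h1 := eq_ofReal_add (⟨A, hA⟩ : complexify 𝔠)
  have h2 := eq_ofReal_add (⟨B, hB⟩ : complexify 𝔠)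
  have h3 : ∀ X Y : 𝔠, ⁅ofReal X, ofReal Y⁆ = 0 := by
    intro X Y
    have : ⁅X, Y⁆ = 0 := Subtype.ext (h𝔠.abelian _ X.2 _ Y.2)
    rw [← ofReal_lie, this]
    ext i j; simp [ofReal]
  have h4 : ⁅(⟨A, hA⟩ : complexify 𝔠), (⟨B, hB⟩ : complexify 𝔠)⁆ = 0 := by
    rw [h1, h2]
    simp [h3]
  exact congrArg Subtype.val h4

/-- The span of 𝔠 and x is again abelian, so maximality absorbs x. -/
theorem IsCartan.mem_of_commute (h𝔠 : IsCartan 𝔤 𝔠) {x : Matrix (Fin n) (Fin n) ℝ} (hx : x ∈ 𝔤)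
    (h : ∀ y ∈ 𝔠, ⁅y, x⁆ = 0) : x ∈ 𝔠 := by
  have hbr : ∀ a ∈ 𝔠.toSubmodule ⊔ Submodule.span ℝ {x},
      ∀ b ∈ 𝔠.toSubmodule ⊔ Submodule.span ℝ {x}, ⁅a, b⁆ = 0 := by
    intro a ha b hb
    obtain ⟨a₁, ha₁, a₂, ha₂, rfl⟩ := Submodule.mem_sup.1 ha
    obtain ⟨b₁, hb₁, b₂, hb₂, rfl⟩ := Submodule.mem_sup.1 hb
    obtain ⟨r, rfl⟩ := Submodule.mem_span_singleton.1 ha₂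
    obtain ⟨s, rfl⟩ := Submodule.mem_span_singleton.1 hb₂
    have h1 : ⁅x, b₁⁆ = 0 := by rw [← lie_skew, h b₁ hb₁, neg_zero]
    simp [h𝔠.abelian a₁ ha₁ b₁ hb₁, h1, h a₁ ha₁]
  let 𝔞 : LieSubalgebra ℝ (Matrix (Fin n) (Fin n) ℝ) :=
    { 𝔠.toSubmodule ⊔ Submodule.span ℝ {x} with
      lie_mem' := fun {a b} ha hb => by
        rw [hbr a ha b hb]; exact Submodule.zero_mem _ }
  have hle : 𝔠.toSubmodule ⊔ Submodule.span ℝ {x} ≤ 𝔤.toSubmodule :=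
    sup_le h𝔠.le ((Submodule.span_singleton_le_iff_mem _ _).2 hx)
  have := h𝔠.maximal 𝔞 (fun y hy => le_sup_left (a := 𝔠.toSubmodule) hy) (fun y hy => hle hy) hbr
  rw [← this]
  exact le_sup_right (a := 𝔠.toSubmodule) (Submodule.mem_span_singleton_self x)

theorem IsCartan.mem_complexify_of_commute (h𝔠 : IsCartan 𝔤 𝔠) {Z : Matrix (Fin n) (Fin n) ℂ}
    (hZ : Z ∈ complexify 𝔤) (h : ∀ A ∈ complexify 𝔠, ⁅A, Z⁆ = 0) : Z ∈ complexify 𝔠 := by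
  have key : ∀ y ∈ 𝔠, ⁅y, Z.map Complex.re⁆ = 0 ∧ ⁅y, Z.map Complex.im⁆ = 0 := by
    intro y hy
    have h1 := h _ (ofReal (⟨y, hy⟩ : 𝔠)).2
    constructor
    · ext i j
      have h2 := congrArg Complex.re (congrFun (congrFun h1 i) j)
      simpa [ofReal, Ring.lie_def, Matrix.mul_apply] using h2
    · ext i j
      have h2 := congrArg Complex.im (congrFun (congrFun h1 i) j)
      simpa [ofReal, Ring.lie_def, Matrix.mul_apply] using h2
  exact ⟨h𝔠.mem_of_commute hZ.1 fun y hy => (key y hy).1,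
    h𝔠.mem_of_commute hZ.2 fun y hy => (key y hy).2⟩

/-- A diagonalizable endomorphism has no Jordan block for the eigenvalue `0`. -/
theorem apply_eq_zero_of_mem_iSup_eigenspace {M : Type*} [AddCommGroup M] [Module ℂ M]
    (T : Module.End ℂ M) {x : M} (hx : x ∈ ⨆ a, T.eigenspace a) (h : T (T x) = 0) : T x = 0 := by
  rw [iSup_split_single _ (0 : ℂ)] at hx
  obtain ⟨y, hy, z, hz, rfl⟩ := Submodule.mem_sup.1 hx
  have hy' : T y = 0 := by simpa using hy
  rw [map_add, hy', zero_add] at h ⊢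
  have h1 : T z ∈ ⨆ a, ⨆ (_ : a ≠ 0), T.eigenspace a := by
    have : (⨆ a, ⨆ (_ : a ≠ (0 : ℂ)), T.eigenspace a) ≤
        (⨆ a, ⨆ (_ : a ≠ (0 : ℂ)), T.eigenspace a).comap T := by
      refine iSup₂_le fun a ha u hu => ?_
      rw [Submodule.mem_comap, Module.End.mem_eigenspace_iff.1 hu]
      exact Submodule.smul_mem _ _
        (le_iSup₂_of_le (f := fun a (_ : a ≠ (0 : ℂ)) => T.eigenspace a) a ha le_rfl hu)
    exact this hz
  exact Submodule.disjoint_def.1 (T.eigenspaces_iSupIndep 0) _ (by simpa using h) h1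

/-- If Z normalizes 𝔠^ℂ, then [A, [A, Z]] = 0 for A in 𝔠^ℂ. As ad A is diagonalizable this forces
[A, Z] = 0, and 𝔠^ℂ is its own centralizer. -/
theorem IsCartan.isCartanSubalgebra (h𝔠 : IsCartan 𝔤 𝔠) :
    (cartanC 𝔤 𝔠).IsCartanSubalgebra where
  nilpotent := by
    have : IsLieAbelian (cartanC 𝔤 𝔠) :=
      ⟨fun a b => Subtype.ext (Subtype.ext (h𝔠.lie_eq_zero a.2 b.2))⟩
    infer_instance
  self_normalizing := by
    refine le_antisymm (fun Z hZ => ?_) (LieSubalgebra.le_normalizer _)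
    rw [LieSubalgebra.mem_normalizer_iff'] at hZ
    refine h𝔠.mem_complexify_of_commute Z.2 fun A hA => ?_
    have hA' : A ∈ complexify 𝔤 := complexify_mono h𝔠.le hA
    have h1 : ⁅A, (Z : Matrix (Fin n) (Fin n) ℂ)⁆ ∈ complexify 𝔠 := hZ ⟨A, hA'⟩ hA
    refine apply_eq_zero_of_mem_iSup_eigenspace (ad ℂ (Matrix (Fin n) (Fin n) ℂ) A) ?_
      (h𝔠.lie_eq_zero hA h1)
    refine (h𝔠.diagonalizable.trans (iSup_le fun α => ?_)) Z.2
    refine le_iSup_of_le (α ⟨A, hA⟩) fun B hB => ?_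
    exact Module.End.mem_eigenspace_iff.2 (hB.2 ⟨A, hA⟩)

/-- The two incarnations of the complexified Cartan subalgebra. -/
def cartanEquiv (h𝔠 : IsCartan 𝔤 𝔠) : complexify 𝔠 ≃ₗ[ℂ] cartanC 𝔤 𝔠 where
  toFun Z := ⟨⟨Z, complexify_mono h𝔠.le Z.2⟩, Z.2⟩
  map_add' _ _ := rfl
  map_smul' _ _ := rfl
  invFun Z := ⟨Z.1.1, Z.2⟩
  left_inv _ := rfl
  right_inv _ := rfl

/-- Transport of linear functionals along `cartanEquiv`. -/
def dualEquiv (h𝔠 : IsCartan 𝔤 𝔠) :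
    Dual ℂ (complexify 𝔠) ≃ₗ[ℂ] Dual ℂ (cartanC 𝔤 𝔠) := (cartanEquiv h𝔠).symm.dualMap

theorem dualEquiv_apply (h𝔠 : IsCartan 𝔤 𝔠) (α : Dual ℂ (complexify 𝔠)) (h : cartanC 𝔤 𝔠) :
    dualEquiv h𝔠 α h = α ((cartanEquiv h𝔠).symm h) := rfl

/-- One side is a generalized weight space and the other a true eigenspace; they agree since a
Cartan subalgebra acts semisimply when the Killing form is nondegenerate. -/
theorem mem_rootSpace_iff [IsKilling ℝ 𝔤] (h𝔠 : IsCartan 𝔤 𝔠)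
    [(cartanC 𝔤 𝔠).IsCartanSubalgebra] (α : Dual ℂ (complexify 𝔠))
    (Z : complexify 𝔤) :
    Z ∈ LieAlgebra.rootSpace (cartanC 𝔤 𝔠) (dualEquiv h𝔠 α) ↔
      (Z : Matrix (Fin n) (Fin n) ℂ) ∈ rootSpace 𝔤 𝔠 α := by
  constructor
  · intro hZ
    refine ⟨Z.2, fun A => ?_⟩
    exact congrArg Subtype.val (IsKilling.lie_eq_smul_of_mem_rootSpace hZ (cartanEquiv h𝔠 A))
  · intro hZ
    refine LieModule.weightSpace_le_genWeightSpace _ _ ?_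
    rw [LieModule.mem_weightSpace]
    exact fun h => Subtype.ext (hZ.2 ((cartanEquiv h𝔠).symm h))

theorem isRoot_iff [IsKilling ℝ 𝔤] (h𝔠 : IsCartan 𝔤 𝔠) [(cartanC 𝔤 𝔠).IsCartanSubalgebra] (α : Dual ℂ (complexify 𝔠)) :
    IsRoot 𝔤 𝔠 α ↔ dualEquiv h𝔠 α ∈ IsKilling.linearRoots (cartanC 𝔤 𝔠) := by
  rw [IsKilling.mem_linearRoots_iff, IsRoot, ne_eq, ne_eq, ne_eq, ne_eq, LinearEquiv.map_eq_zero_iff]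
  refine and_congr_right fun _ => not_congr ?_
  rw [Submodule.eq_bot_iff, LieSubmodule.eq_bot_iff]
  constructor
  · intro h Z hZ
    exact Subtype.ext (h _ ((mem_rootSpace_iff h𝔠 α Z).1 hZ))
  · intro h Z hZ
    exact congrArg Subtype.val (h ⟨Z, hZ.1⟩ ((mem_rootSpace_iff h𝔠 α ⟨Z, hZ.1⟩).2 hZ))

/-- The coroot functional of a linear functional on the complexified Cartan subalgebra. -/
def corootC [IsKilling ℝ 𝔤] (h𝔠 : IsCartan 𝔤 𝔠) (α : Dual ℂ (complexify 𝔠)) : Dual ℂ (Dual ℂ (complexify 𝔠)) :=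
  haveI := h𝔠.isCartanSubalgebra
  (Dual.eval ℂ _ (IsKilling.linearCoroot (dualEquiv h𝔠 α))).comp
    (dualEquiv h𝔠 : Dual ℂ (complexify 𝔠) →ₗ[ℂ] Dual ℂ (cartanC 𝔤 𝔠))

theorem isRootFamily_complexify [IsKilling ℝ 𝔤] (h𝔠 : IsCartan 𝔤 𝔠) :
    IsRootFamily {α | IsRoot 𝔤 𝔠 α} (corootC h𝔠) := by
  have := h𝔠.isCartanSubalgebra
  have h := (IsKilling.isRootFamily (cartanC 𝔤 𝔠)).preimage (dualEquiv h𝔠)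
  convert h using 1
  · ext α
    exact isRoot_iff h𝔠 α
  · rfl

/-- In an 𝔰𝔩₂-triple on root vectors of ±α the neutral element is forced to be the coroot, so the
reflection does not depend on the chosen triple. -/
theorem reflection_eq [IsKilling ℝ 𝔤] (h𝔠 : IsCartan 𝔤 𝔠)
    {P : Set (Dual ℂ (complexify 𝔠))} (hP : IsPositiveSystem 𝔤 𝔠 P)
    (t : SimpleTriple 𝔤 𝔠 P) : t.reflection = Module.preReflection t.α (corootC h𝔠 t.α) := by
  have := h𝔠.isCartanSubalgebra
  obtain ⟨β, hβ, hβα⟩ := (isRoot_iff h𝔠 t.α).1 (hP.isRoot _ t.simple.1)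
  have hfun : (β : cartanC 𝔤 𝔠 → ℂ) = dualEquiv h𝔠 t.α := by rw [← hβα]; rfl
  have hX : t.X ∈ LieAlgebra.rootSpace (cartanC 𝔤 𝔠) β := by
    rw [hfun, mem_rootSpace_iff]; exact t.X_mem
  have hY : t.Y ∈ LieAlgebra.rootSpace (cartanC 𝔤 𝔠) (-β : cartanC 𝔤 𝔠 → ℂ) := by
    have h1 : (-β : cartanC 𝔤 𝔠 → ℂ) = dualEquiv h𝔠 (-t.α) := by rw [hfun, map_neg]; rfl
    rw [h1, mem_rootSpace_iff]; exact t.Y_mem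
  have hsl : IsSl2Triple (cartanEquiv h𝔠 t.H : complexify 𝔤) t.X t.Y :=
    ⟨fun h => t.sl2.h_ne_zero (congrArg Subtype.val h), Subtype.ext t.sl2.lie_e_f,
      Subtype.ext t.sl2.lie_h_e_nsmul, Subtype.ext t.sl2.lie_h_f_nsmul⟩
  have hH := hsl.h_eq_coroot hβ hX hY
  have hH' : cartanEquiv h𝔠 t.H = IsKilling.linearCoroot (dualEquiv h𝔠 t.α) := by
    rw [← hβα, IsKilling.linearCoroot_toLinear]; exact Subtype.ext hH
  have : Dual.eval ℂ (complexify 𝔠) t.H = corootC h𝔠 t.α := by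
    ext μ
    change μ t.H = dualEquiv h𝔠 μ (IsKilling.linearCoroot (dualEquiv h𝔠 t.α))
    rw [← hH', dualEquiv_apply, LinearEquiv.symm_apply_apply]
  rw [SimpleTriple.reflection, this]

theorem exists_simpleTriple [IsKilling ℝ 𝔤] (h𝔠 : IsCartan 𝔤 𝔠)
    {P : Set (Dual ℂ (complexify 𝔠))} (hP : IsPositiveSystem 𝔤 𝔠 P)
    {α : Dual ℂ (complexify 𝔠)} (hα : IsSimpleRoot P α) : ∃ t : SimpleTriple 𝔤 𝔠 P, t.α = α := by
  have := h𝔠.isCartanSubalgebra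
  obtain ⟨β, hβ, hβα⟩ := (isRoot_iff h𝔠 α).1 (hP.isRoot _ hα.1)
  have hfun : (β : cartanC 𝔤 𝔠 → ℂ) = dualEquiv h𝔠 α := by rw [← hβα]; rfl
  obtain ⟨h, e, f, t, he, hf⟩ := IsKilling.exists_isSl2Triple_of_weight_isNonZero hβ
  obtain rfl := t.h_eq_coroot hβ he hf
  rw [hfun, mem_rootSpace_iff] at he
  have h1 : (-β : cartanC 𝔤 𝔠 → ℂ) = dualEquiv h𝔠 (-α) := by rw [hfun, map_neg]; rfl
  rw [h1, mem_rootSpace_iff] at hf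
  exact ⟨⟨α, e, f, (cartanEquiv h𝔠).symm (IsKilling.coroot β), hα, he, hf,
    ⟨fun h => t.h_ne_zero (Subtype.ext h), congrArg Subtype.val t.lie_e_f,
      congrArg Subtype.val t.lie_h_e_nsmul, congrArg Subtype.val t.lie_h_f_nsmul⟩⟩, rfl⟩

end RealRep

namespace RealRep

open Module

variable {n : ℕ} {𝔤 𝔠 : LieSubalgebra ℝ (Matrix (Fin n) (Fin n) ℝ)}

/-! ### Conjugations -/

theorem conjL_conjL (Z : complexify 𝔤) : conjL (conjL Z) = Z := by
  ext i j; simp [conjL]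

theorem conjDual_conjDual (μ : Dual ℂ (complexify 𝔠)) : conjDual (conjDual μ) = μ := by
  ext H
  change starRingEnd ℂ (starRingEnd ℂ (μ (conjL (conjL H)))) = μ H
  rw [conjL_conjL, Complex.conj_conj]

/-- The map `μ ↦ μ^σ`, as a homomorphism of additive groups. -/
def conjDualHom (𝔠 : LieSubalgebra ℝ (Matrix (Fin n) (Fin n) ℝ)) :
    Dual ℂ (complexify 𝔠) →+ Dual ℂ (complexify 𝔠) where
  toFun := conjDual
  map_zero' := by ext H; simp [conjDual]
  map_add' μ ν := by ext H; simp [conjDual]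

theorem conjL_mem_rootSpace {α : Dual ℂ (complexify 𝔠)} {Z : complexify 𝔤}
    (hZ : (Z : Matrix (Fin n) (Fin n) ℂ) ∈ rootSpace 𝔤 𝔠 α) :
    (conjL Z : Matrix (Fin n) (Fin n) ℂ) ∈ rootSpace 𝔤 𝔠 (conjDual α) := by
  refine ⟨(conjL Z).2, fun H => ?_⟩
  have h1 := hZ.2 (conjL H)
  ext i j
  have h2 := congrArg (starRingEnd ℂ) (congrFun (congrFun h1 i) j)
  simpa [conjL, conjDual, Ring.lie_def, Matrix.mul_apply] using h2

theorem IsRoot.conjDual {α : Dual ℂ (complexify 𝔠)} (hα : IsRoot 𝔤 𝔠 α) :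
    IsRoot 𝔤 𝔠 (conjDual α) := by
  refine ⟨fun h => hα.1 ?_, fun h => hα.2 ?_⟩
  · rw [← conjDual_conjDual α, h]; exact map_zero (conjDualHom 𝔠)
  · rw [Submodule.eq_bot_iff] at h ⊢
    intro Z hZ
    have h1 : conjL (⟨Z, hZ.1⟩ : complexify 𝔤) = 0 :=
      Subtype.ext (h _ (conjL_mem_rootSpace (Z := ⟨Z, hZ.1⟩) hZ))
    have h2 := conjL_conjL (⟨Z, hZ.1⟩ : complexify 𝔤)
    rw [h1] at h2
    have h3 : Z = (conjL (0 : complexify 𝔤) : Matrix (Fin n) (Fin n) ℂ) :=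
      (congrArg Subtype.val h2).symm
    rw [h3]
    ext i j; simp [conjL]

theorem IsPositiveSystem.isPositive {P : Set (Dual ℂ (complexify 𝔠))}
    (hP : IsPositiveSystem 𝔤 𝔠 P) : IsPositive {α | IsRoot 𝔤 𝔠 α} P :=
  ⟨hP.isRoot, hP.pos_or_neg, hP.neg_notMem, hP.closed⟩

/-- Conjugation permutes the root spaces, so σ(R⁺) is a positive system, joined to R⁺ by a word of
simple reflections. It remains to choose a triple for each letter. -/
theorem exists_isConjugatingWord [LieAlgebra.IsKilling ℝ 𝔤] (h𝔠 : IsCartan 𝔤 𝔠)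
    {P : Set (Dual ℂ (complexify 𝔠))} (hP : IsPositiveSystem 𝔤 𝔠 P) :
    ∃ s : List (SimpleTriple 𝔤 𝔠 P), IsConjugatingWord s := by
  obtain ⟨l, hl, hl'⟩ := hP.isPositive.exists_word (isRootFamily_complexify h𝔠)
    (hP.isPositive.image_of_involutive (f := conjDualHom 𝔠) conjDual_conjDual
      fun _ hx => IsRoot.conjDual hx)
  have key : ∃ s : List (SimpleTriple 𝔤 𝔠 P), s.map SimpleTriple.reflection =
      l.map fun α => Module.preReflection α (corootC h𝔠 α) := by
    clear hl'
    induction l with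
    | nil => exact ⟨[], rfl⟩
    | cons α l ih =>
      obtain ⟨s, hs⟩ := ih fun β hβ => hl β (List.mem_cons_of_mem _ hβ)
      obtain ⟨t, ht⟩ := exists_simpleTriple h𝔠 hP (hl α List.mem_cons_self)
      exact ⟨t :: s, by rw [List.map_cons, List.map_cons, hs, reflection_eq h𝔠 hP, ht]⟩
  obtain ⟨s, hs⟩ := key
  exact ⟨s, by rw [IsConjugatingWord, hs]; exact hl'⟩

/-! ### The Weyl group elements normalize the Cartan subalgebra -/

section Weyl

variable {P : Set (Dual ℂ (complexify 𝔠))}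

theorem SimpleTriple.weyl_conj_apply (t : SimpleTriple 𝔤 𝔠 P) (Z : complexify 𝔠) :
    t.weyl.val * (Z : Matrix (Fin n) (Fin n) ℂ) * (t.weyl⁻¹).val =
      (Z - t.α Z • t.H : complexify 𝔠) := by
  have hX := t.X_mem.2 Z
  have hY := t.Y_mem.2 Z
  rw [LinearMap.neg_apply, neg_smul] at hY
  exact weyl_conj t.sl2 hX hY

theorem SimpleTriple.α_H (t : SimpleTriple 𝔤 𝔠 P) : t.α t.H = 2 := by
  have h1 := t.X_mem.2 t.H
  rw [t.sl2.lie_h_e_smul ℂ] at h1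
  exact (smul_left_injective ℂ t.sl2.e_ne_zero h1).symm

/-- A reflection is an involution, so both conjugations act on 𝔠^ℂ by the same formula. -/
theorem SimpleTriple.weyl_inv_conj_apply (t : SimpleTriple 𝔤 𝔠 P) (Z : complexify 𝔠) :
    (t.weyl⁻¹).val * (Z : Matrix (Fin n) (Fin n) ℂ) * t.weyl.val =
      (Z - t.α Z • t.H : complexify 𝔠) := by
  have h1 := t.weyl_conj_apply (Z - t.α Z • t.H)
  have h2 : Z - t.α Z • t.H - t.α (Z - t.α Z • t.H) • t.H = Z := by
    rw [map_sub, map_smul, t.α_H, smul_eq_mul]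
    module
  rw [h2] at h1
  rw [← h1, mul_assoc t.weyl.val, Units.inv_mul_cancel_left, mul_assoc, Units.inv_mul, mul_one]

theorem SimpleTriple.weyl_mem (t : SimpleTriple 𝔤 𝔠 P) : t.weyl ∈ cartanNormalizer 𝔠 := by
  intro Z
  constructor
  · intro h
    have h1 := t.weyl_inv_conj_apply ⟨_, h⟩
    have h2 : (t.weyl⁻¹).val * (t.weyl.val * Z * (t.weyl⁻¹).val) * t.weyl.val = Z := by
      rw [mul_assoc t.weyl.val, Units.inv_mul_cancel_left, mul_assoc, Units.inv_mul, mul_one]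
    rw [← h2, h1]
    exact Subtype.property _
  · intro h
    rw [t.weyl_conj_apply ⟨Z, h⟩]
    exact Subtype.property _

theorem omega_mem (s : List (SimpleTriple 𝔤 𝔠 P)) : omega s ∈ cartanNormalizer 𝔠 := by
  refine Subgroup.list_prod_mem _ fun g hg => ?_
  obtain ⟨t, _, rfl⟩ := List.mem_map.1 hg
  exact t.weyl_mem

theorem dualAct_one (μ : Dual ℂ (complexify 𝔠)) : dualAct 1 μ = μ := by
  ext H
  exact congrArg μ (Subtype.ext (by simp))

theorem dualAct_mul (g h : cartanNormalizer 𝔠) (μ : Dual ℂ (complexify 𝔠)) :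
    dualAct (g * h) μ = dualAct g (dualAct h μ) := by
  ext H
  exact congrArg μ (Subtype.ext (by simp [mul_assoc]))

theorem SimpleTriple.dualAct_weyl (t : SimpleTriple 𝔤 𝔠 P) (μ : Dual ℂ (complexify 𝔠)) :
    dualAct ⟨t.weyl, t.weyl_mem⟩ μ = t.reflection μ := by
  ext H
  have h1 : dualAct ⟨t.weyl, t.weyl_mem⟩ μ H = μ (H - t.α H • t.H) :=
    congrArg μ (Subtype.ext (t.weyl_inv_conj_apply H))
  rw [h1, SimpleTriple.reflection, Module.preReflection_apply, map_sub, map_smul]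
  simp [mul_comm]

theorem dualAct_omega (s : List (SimpleTriple 𝔤 𝔠 P)) (μ : Dual ℂ (complexify 𝔠)) :
    dualAct ⟨omega s, omega_mem s⟩ μ = (s.map SimpleTriple.reflection).prod μ := by
  induction s with
  | nil => exact dualAct_one μ
  | cons t s ih =>
    have h : (⟨omega (t :: s), omega_mem (t :: s)⟩ : cartanNormalizer 𝔠) =
        ⟨t.weyl, t.weyl_mem⟩ * ⟨omega s, omega_mem s⟩ := Subtype.ext (by simp [omega])
    rw [h, dualAct_mul, ih, t.dualAct_weyl, List.map_cons, List.prod_cons, Module.End.mul_apply]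

theorem conj_mem_rootSpace {g : cartanNormalizer 𝔠} {α : Dual ℂ (complexify 𝔠)}
    {Z Z' : Matrix (Fin n) (Fin n) ℂ} (hZ : Z ∈ rootSpace 𝔤 𝔠 α) (hZ' : Z' ∈ complexify 𝔤)
    (h : g.1.val * Z * (g.1⁻¹).val = Z') : Z' ∈ rootSpace 𝔤 𝔠 (dualAct g α) := by
  refine ⟨hZ', fun H => ?_⟩
  have h1 : (g.1⁻¹).val * (H : Matrix (Fin n) (Fin n) ℂ) * g.1.val ∈ complexify 𝔠 := by
    simpa using ((g⁻¹).2 (H : Matrix (Fin n) (Fin n) ℂ)).2 H.2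
  have h2 := hZ.2 ⟨_, h1⟩
  have h3 : dualAct g α H = α ⟨_, h1⟩ := rfl
  rw [h3, ← h]
  have h4 := congrArg (fun M => g.1.val * M * (g.1⁻¹).val) h2
  simp only [Ring.lie_def, mul_smul_comm, smul_mul_assoc, mul_sub, sub_mul] at h4
  rw [← h4, Ring.lie_def]
  simp only [mul_assoc, Units.mul_inv_cancel_left, Units.mul_inv, mul_one]

end Weyl

/-! ### High weight vectors -/

section Rep

variable {V : Type*} [AddCommGroup V] [Module ℝ V] [Module.Finite ℝ V]
  {P : Set (Dual ℂ (complexify 𝔠))}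

theorem conjV_conjV (v : ℂ ⊗[ℝ] V) : conjV (conjV v) = v := by
  induction v using TensorProduct.induction_on with
  | zero => simp
  | tmul z v => simp [conjV]
  | add x y hx hy => rw [map_add, map_add, hx, hy]

theorem conjV_smul (z : ℂ) (v : ℂ ⊗[ℝ] V) : conjV (z • v) = starRingEnd ℂ z • conjV v := by
  induction v using TensorProduct.induction_on with
  | zero => simp
  | tmul w v => simp [conjV, TensorProduct.smul_tmul']
  | add x y hx hy => rw [smul_add, map_add, hx, hy, map_add, smul_add]

theorem conjV_baseChange (f : Module.End ℝ V) (v : ℂ ⊗[ℝ] V) :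
    conjV (f.baseChange ℂ v) = f.baseChange ℂ (conjV v) := by
  induction v using TensorProduct.induction_on with
  | zero => simp
  | tmul w v => simp [conjV]
  | add x y hx hy => rw [map_add, map_add, hx, hy, map_add, map_add]

theorem rhoC_conjL (ρ : 𝔤 →ₗ⁅ℝ⁆ Module.End ℝ V) (Z : complexify 𝔤) (v : ℂ ⊗[ℝ] V) :
    rhoC ρ (conjL Z) (conjV v) = conjV (rhoC ρ Z v) := by
  have h1 : rePart (conjL Z) = rePart Z := by ext i j; simp [rePart, conjL]
  have h2 : imPart (conjL Z) = -imPart Z := by ext i j; simp [imPart, conjL]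
  have h3 : (-ρ (imPart Z)).baseChange ℂ = -(ρ (imPart Z)).baseChange ℂ :=
    LinearMap.baseChange_neg _
  rw [rhoC_of_real, rhoC_of_real, h1, h2, map_add, conjV_smul, conjV_baseChange, conjV_baseChange,
    map_neg, h3, Complex.conj_I, neg_smul, LinearMap.neg_apply, smul_neg]

theorem conjV_ne_zero {v : ℂ ⊗[ℝ] V} (hv : v ≠ 0) : conjV v ≠ 0 := fun h =>
  hv (by rw [← conjV_conjV v, h, map_zero])

/-- High weight vectors are killed by the root spaces of the positive roots. -/
theorem isHighWeightVector_iff {ρ : 𝔤 →ₗ⁅ℝ⁆ Module.End ℝ V} {v : ℂ ⊗[ℝ] V}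
    {μ : Dual ℂ (complexify 𝔠)} : IsHighWeightVector P ρ v μ ↔ v ≠ 0 ∧
      (∀ α ∈ P, ∀ Z : complexify 𝔤, (Z : Matrix (Fin n) (Fin n) ℂ) ∈ rootSpace 𝔤 𝔠 α →
        rhoC ρ Z v = 0) ∧
      ∀ (H : complexify 𝔤) (hH : (H : Matrix (Fin n) (Fin n) ℂ) ∈ complexify 𝔠),
        rhoC ρ H v = μ ⟨H, hH⟩ • v := by
  constructor
  · exact fun h => ⟨h.ne_zero, fun α hα Z hZ => h.nil Z
      (le_iSup₂_of_le (f := fun α (_ : α ∈ P) => rootSpace 𝔤 𝔠 α) α hα le_rfl hZ), h.weight⟩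
  · rintro ⟨h0, h1, h2⟩
    refine ⟨h0, fun N hN => ?_, h2⟩
    have hle : nilradical 𝔤 𝔠 P ≤ ((LinearMap.ker ((LinearMap.applyₗ v).comp
        (rhoC ρ : complexify 𝔤 →ₗ[ℂ] Module.End ℂ (ℂ ⊗[ℝ] V)))).map
        (complexify 𝔤).toSubmodule.subtype) :=
      iSup₂_le fun α hα Z hZ => ⟨⟨Z, hZ.1⟩, h1 α hα _ hZ, rfl⟩
    obtain ⟨N', hN', hN''⟩ := hle hN
    have : N' = N := Subtype.ext hN''
    rw [← this]
    exact hN'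

/-- For Z in a positive root space 𝔤_α, conjugation by ω lands in the root space of ωα, which is β^σ
for some positive β. Its conjugate lies in 𝔤_β and kills v, so ρ^ℂ(Z) kills ω_ρ⁻¹ v̄. The weight is
found in the same way from 𝔠^ℂ. -/
theorem isHighWeightVector_omegaRho_inv {ρ : 𝔤 →ₗ⁅ℝ⁆ Module.End ℝ V}
    {s : List (SimpleTriple 𝔤 𝔠 P)} (hs : IsConjugatingWord s) {v : ℂ ⊗[ℝ] V}
    {μ : Dual ℂ (complexify 𝔠)} (hv : IsHighWeightVector P ρ v μ) :
    IsHighWeightVector P ρ (((omegaRho ρ s)⁻¹).val (conjV v))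
      (dualAct (⟨omega s, omega_mem s⟩⁻¹ : cartanNormalizer 𝔠) (conjDual μ)) := by
  obtain ⟨h0, h1, h2⟩ := isHighWeightVector_iff.1 hv
  have hmul : ∀ w, (omegaRho ρ s).val (((omegaRho ρ s)⁻¹).val w) = w := fun w => by
    rw [← Module.End.mul_apply, Units.mul_inv, Module.End.one_apply]
  have hmul' : ∀ w, ((omegaRho ρ s)⁻¹).val ((omegaRho ρ s).val w) = w := fun w => by
    rw [← Module.End.mul_apply, Units.inv_mul, Module.End.one_apply]
  have hconj : ∀ Z Z' : complexify 𝔤,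
      (omegaRho ρ s).val * rhoC ρ Z * ((omegaRho ρ s)⁻¹).val = rhoC ρ Z' → ∀ w,
      rhoC ρ Z (((omegaRho ρ s)⁻¹).val w) = ((omegaRho ρ s)⁻¹).val (rhoC ρ Z' w) := by
    intro Z Z' h w
    rw [← h, Module.End.mul_apply, Module.End.mul_apply, hmul']
  refine isHighWeightVector_iff.2 ⟨fun h => conjV_ne_zero h0 ?_, fun α hα Z hZ => ?_,
    fun H hH => ?_⟩
  · rw [← hmul (conjV v), h, map_zero]
  · obtain ⟨Z', hZ', hρ⟩ := (omega_mem_intertwiningSubgroup ρ s).1 Z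
    rw [hconj Z Z' hρ]
    have h3 := conj_mem_rootSpace (g := ⟨omega s, omega_mem s⟩) hZ Z'.2 hZ'
    rw [dualAct_omega] at h3
    obtain ⟨β, hβ, hβ'⟩ : (s.map SimpleTriple.reflection).prod α ∈ conjDual '' P := by
      rw [← hs]; exact ⟨α, hα, rfl⟩
    rw [← hβ'] at h3
    have h4 := conjL_mem_rootSpace h3
    rw [conjDual_conjDual] at h4
    rw [← conjL_conjL Z', rhoC_conjL, h1 β hβ _ h4, map_zero, map_zero]
  · obtain ⟨H', hH', hρ⟩ := (omega_mem_intertwiningSubgroup ρ s).1 H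
    rw [hconj H H' hρ]
    have h3 : (H' : Matrix (Fin n) (Fin n) ℂ) ∈ complexify 𝔠 := by
      rw [← hH']; exact (omega_mem s _).2 hH
    have h4 : (conjL H' : Matrix (Fin n) (Fin n) ℂ) ∈ complexify 𝔠 :=
      (conjL (⟨H', h3⟩ : complexify 𝔠)).2
    rw [← conjL_conjL H', rhoC_conjL, h2 _ h4, conjV_smul, map_smul]
    congr 1
    refine congrArg (fun K => starRingEnd ℂ (μ (conjL K)))
      (Subtype.ext ?_ : (⟨H', h3⟩ : complexify 𝔠) = _)
    change (H' : Matrix (Fin n) (Fin n) ℂ) = _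
    rw [← hH']
    simp

theorem IsHighWeightVector.eq_bot_or_mem [LieAlgebra.IsKilling ℝ 𝔤] (h𝔠 : IsCartan 𝔤 𝔠)
    (hP : IsPositiveSystem 𝔤 𝔠 P) {ρ : 𝔤 →ₗ⁅ℝ⁆ Module.End ℝ V} {w : ℂ ⊗[ℝ] V}
    {μ : Dual ℂ (complexify 𝔠)} (hw : IsHighWeightVector P ρ w μ)
    {U : Submodule ℂ (ℂ ⊗[ℝ] V)} (hU : IsInvariant ρ U)
    (hwU : ∀ N : Submodule ℂ (ℂ ⊗[ℝ] V), IsInvariant ρ N → w ∈ N → U ≤ N)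
    {N : Submodule ℂ (ℂ ⊗[ℝ] V)} (hN : IsInvariant ρ N) (hNU : N ≤ U) : N = ⊥ ∨ w ∈ N := by
  have := h𝔠.isCartanSubalgebra
  -- Invariant subspaces become Lie submodules for this action, and the criterion for modules over a
  -- complex Killing Lie algebra applies.
  let : LieRingModule (complexify 𝔤) (ℂ ⊗[ℝ] V) :=
    LieRingModule.compLieHom (ℂ ⊗[ℝ] V) (rhoC ρ)
  have : LieModule ℂ (complexify 𝔤) (ℂ ⊗[ℝ] V) := LieModule.compLieHom (ℂ ⊗[ℝ] V) (rhoC ρ)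
  have hP' : IsPositive (LieAlgebra.IsKilling.linearRoots (cartanC 𝔤 𝔠))
      ((dualEquiv h𝔠).symm ⁻¹' P) := by
    have h1 := hP.isPositive.preimage (dualEquiv h𝔠).symm
    convert h1 using 1
    ext α
    change _ ↔ IsRoot 𝔤 𝔠 ((dualEquiv h𝔠).symm α)
    rw [isRoot_iff h𝔠, LinearEquiv.apply_symm_apply]
  have hhigh : LieAlgebra.IsKilling.IsHighest ((dualEquiv h𝔠).symm ⁻¹' P) w (dualEquiv h𝔠 μ) := by
    obtain ⟨h0, h1, h2⟩ := isHighWeightVector_iff.1 hw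
    refine ⟨h0, fun α hα e he => h1 _ hα e ?_, fun h => h2 h.1 h.2⟩
    rwa [← mem_rootSpace_iff h𝔠, LinearEquiv.apply_symm_apply]
  let N' : LieSubmodule ℂ (complexify 𝔤) (ℂ ⊗[ℝ] V) :=
    { N with lie_mem := fun {Z u} hu => hN Z u hu }
  let U' : LieSubmodule ℂ (complexify 𝔤) (ℂ ⊗[ℝ] V) :=
    { U with lie_mem := fun {Z u} hu => hU Z u hu }
  rcases hhigh.eq_bot_or_mem hP' U' (fun M hM => hwU M.toSubmodule
    (fun Z u hu => M.lie_mem hu) hM) N' hNU with h | h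
  · exact Or.inl (congrArg LieSubmodule.toSubmodule h)
  · exact Or.inr h

end Rep

end RealRep

end

/-! ### The main theorem -/

open RealRep in
theorem lemma4p4 {n : ℕ} (𝔤 𝔠 : LieSubalgebra ℝ (Matrix (Fin n) (Fin n) ℝ))
    [LieAlgebra.IsSemisimple ℝ 𝔤] (h𝔠 : IsCartan 𝔤 𝔠)
    (P : Set (Module.Dual ℂ (complexify 𝔠))) (hP : IsPositiveSystem 𝔤 𝔠 P)
    {V : Type*} [AddCommGroup V] [Module ℝ V] [Module.Finite ℝ V]
    (ρ : 𝔤 →ₗ⁅ℝ⁆ Module.End ℝ V) :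
    (∃ s : List (SimpleTriple 𝔤 𝔠 P), IsConjugatingWord s) ∧
    ∀ s : List (SimpleTriple 𝔤 𝔠 P), IsConjugatingWord s →
      ∃ hω : omega s ∈ cartanNormalizer 𝔠,
        ∀ (v : ℂ ⊗[ℝ] V) (μ : Module.Dual ℂ (complexify 𝔠)),
          IsHighWeightVector P ρ v μ →
            IsHighWeightVector P ρ
              (((omegaRho ρ s)⁻¹ : LinearMap.GeneralLinearGroup ℂ (ℂ ⊗[ℝ] V)).val
                (conjV v))
              (dualAct (⟨omega s, hω⟩⁻¹ : cartanNormalizer 𝔠) (conjDual μ)) ∧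
            IsIrreducible ρ (orbitSpan ρ (conjV v)) ∧
            ((omegaRho ρ s)⁻¹ : LinearMap.GeneralLinearGroup ℂ (ℂ ⊗[ℝ] V)).val
                (conjV v) ∈ orbitSpan ρ (conjV v) ∧
            ∀ U : Submodule ℂ (ℂ ⊗[ℝ] V), IsIrreducible ρ U →
              ((omegaRho ρ s)⁻¹ : LinearMap.GeneralLinearGroup ℂ (ℂ ⊗[ℝ] V)).val
                (conjV v) ∈ U →
              U = orbitSpan ρ (conjV v) := by
  have : LieAlgebra.IsKilling ℝ 𝔤 := inferInstance
  refine ⟨exists_isConjugatingWord h𝔠 hP, fun s hs => ⟨omega_mem s, fun v μ hv => ?_⟩⟩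
  have hw := isHighWeightVector_omegaRho_inv hs hv
  set w := ((omegaRho ρ s)⁻¹ : LinearMap.GeneralLinearGroup ℂ (ℂ ⊗[ℝ] V)).val (conjV v) with hw_def
  -- Applying ω_ρ to w recovers v̄ inside N, so w generates the orbit span of v̄.
  have hle : ∀ N : Submodule ℂ (ℂ ⊗[ℝ] V), IsInvariant ρ N → w ∈ N →
      orbitSpan ρ (conjV v) ≤ N := by
    intro N hN hwN
    refine orbitSpan_le ρ hN ?_
    have h1 := (omegaRho_apply_mem ρ hN s w hwN).1
    rwa [hw_def, ← Module.End.mul_apply, Units.mul_inv, Module.End.one_apply] at h1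
  have hinv := isInvariant_orbitSpan ρ (conjV v)
  have hmem : w ∈ orbitSpan ρ (conjV v) :=
    (omegaRho_apply_mem ρ hinv s _ (mem_orbitSpan ρ (conjV v))).2
  have hne : orbitSpan ρ (conjV v) ≠ ⊥ := fun h =>
    conjV_ne_zero hv.ne_zero ((Submodule.mem_bot ℂ).1 (h ▸ mem_orbitSpan ρ (conjV v)))
  refine ⟨hw, ⟨hne, hinv, fun U hU hUinv => ?_⟩, hmem, fun U hU hwU => ?_⟩
  · exact (hw.eq_bot_or_mem h𝔠 hP hinv hle hUinv hU).imp_right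
      fun h => le_antisymm hU (hle U hUinv h)
  -- The orbit span is a nonzero invariant subspace of the irreducible U.
  · exact ((hU.eq_bot_or_eq _ (hle U hU.invariant hwU) hinv).resolve_left hne).symm
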